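/- Let $n\in\mathbb N=\{1,2,\dots\}$ and $\alpha>-1$. Let $\mu_\alpha$ be the probability measure $d\mu_\alpha(z)=\frac{\alpha+1}{\pi}(1-|z|^2)^\alpha\,dx\,dy$ on the unit disk $\mathbb D$, and let $\mathcal A_n^2(\mathbb D,\mu_\alpha)$ be the space of $n$-analytic functions on $\mathbb D$ (functions $f$ of class $C^n$ with $(\partial/\partial\overline z)^n f=0$) that are square integrable with respect to $\mu_\alpha$, with the inner product of $L^2(\mathbb D,\mu_\alpha)$; it is a Hilbert space. For $\tau\in\mathbb T$ let $(\rho_n^{(\alpha)}(\tau)f)(z)=f(\tau^{-1}z)$, $f\in\mathcal A_n^2(\mathbb D,\mu_\alpha)$, and let $\mathcal R_n^{(\alpha)}$ be the set of radial operators, i.e. of the bounded linear operators on $\mathcal A_n^2(\mathbb D,\mu_\alpha)$ that commute with $\rho_n^{(\alpha)}(\tau)$ for every $\tau\in\mathbb T$. For $\xi\in\mathbb Z$ and $s\in\mathbb N$ let $$\mathcal W^{(\alpha)}_{\xi,s}=\operatorname{span}\{z^p\overline z^q:\ p,q\in\mathbb N_0,\ p-q=\xi,\ \min\{p,q\}<s\}\subset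 L^2(\mathbb D,\mu_\alpha).$$ For $p,q\in\mathbb N_0$ let $b^{(\alpha)}_{p,q}$ be the normalized disk polynomial $$b^{(\alpha)}_{p,q}(z)=\sqrt{\frac{(\alpha+p+q+1)\,p!\,q!}{(\alpha+1)\Gamma(\alpha+p+1)\Gamma(\alpha+q+1)}}\ \sum_{k=0}^{\min\{p,q\}}(-1)^k\frac{\Gamma(\alpha+p+q+1-k)}{k!\,(p-k)!\,(q-k)!}\,z^{p-k}\overline z^{\,q-k}.$$ Let $\mathfrak M_n=\bigoplus_{\xi=-n+1}^\infty\mathcal M_{\min\{n,n+\xi\}}$ be the algebra of all sequences $(A_\xi)_{\xi\ge-n+1}$ of complex square matrices, $A_\xi$ of order $\min\{n,n+\xi\}$, with $\sup_\xi\|A_\xi\|<\infty$ (operator norms), with componentwise operations and the supremum norm; its elements are identified with the block diagonal bounded operators that they define on the Hilbert space $\bigoplus_{\xi=-n+1}^\infty\mathbb C^{\min\{n,n+\xi\}}$. The components of the vectors in $\mathbb C^{\min\{n,n+\xi\}}$ are enumerated by $q$ with $\max\{0,-\xi\}\le q\le n-1$. **Theorem 7.1.** The set $\mathcal R_n^{(\alpha)}$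 is a von Neumann algebra. It consists of all bounded linear operators on $\mathcal A_n^2(\mathbb D,\mu_\alpha)$ that leave each subspace $\mathcal W^{(\alpha)}_{\xi,\min\{n,n+\xi\}}$, $\xi\ge-n+1$, invariant. Furthermore, the restriction map $S\mapsto\bigl(S|_{\mathcal W^{(\alpha)}_{\xi,\min\{n,n+\xi\}}}\bigr)_{\xi\ge-n+1}$ is an isometric $*$-isomorphism $$\mathcal R_n^{(\alpha)}\cong\bigoplus_{\xi=-n+1}^\infty\mathcal B\bigl(\mathcal W^{(\alpha)}_{\xi,\min\{n,n+\xi\}}\bigr)$$ onto the algebra of norm-bounded sequences of operators. The rule $$(U_n^{(\alpha)}f)_{\xi,q}=\langle f,b^{(\alpha)}_{q+\xi,q}\rangle\qquad(\xi\ge-n+1,\ \max\{0,-\xi\}\le q\le n-1)$$ defines a unitary operator $U_n^{(\alpha)}\colon\mathcal A_n^2(\mathbb D,\mu_\alpha)\to\bigoplus_{\xi=-n+1}^\infty\mathbb C^{\min\{n,n+\xi\}}$, and $\mathcal R_n^{(\alpha)}$ is spatially isomorphic to $\mathfrak M_n$ through it: $$U_n^{(\alpha)}\,\mathcal R_n^{(\alpha)}\,(U_n^{(\alpha)})^*=\mathfrak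 M_n,$$ where $S\mapsto U_n^{(\alpha)}S(U_n^{(\alpha)})^*$ is an isometric $*$-isomorphism of $\mathcal R_n^{(\alpha)}$ onto $\mathfrak M_n$. In particular, $\mathcal R_n^{(\alpha)}$ is noncommutative if $n\ge2$. -/

import Mathlib

open MeasureTheory
open scoped ENNReal ComplexConjugate Matrix.Norms.L2Operator

noncomputable section

namespace PolyBergman

/-! ### The weighted measure on the unit disk -/

/-- The open unit disk in the complex plane. -/
abbrev unitDisk : Set ℂ := Metric.ball (0 : ℂ) 1

/-- The weighted Lebesgue measure on the unit disk with density
`(α + 1) / π * (1 - |z|^2) ^ α`. -/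
def diskMeasure (α : ℝ) : Measure ℂ :=
  (volume.restrict unitDisk).withDensity
    fun z => ENNReal.ofReal ((α + 1) / Real.pi * (1 - ‖z‖ ^ 2) ^ α)

/-- The Hilbert space of (classes of) functions on the unit disk that are
square integrable with respect to the weighted measure. -/
abbrev L2 (α : ℝ) : Type := Lp ℂ 2 (diskMeasure α)

lemma ae_mem_unitDisk (α : ℝ) : ∀ᵐ z ∂(diskMeasure α), z ∈ unitDisk :=
  (withDensity_absolutelyContinuous _ _).ae_le (ae_restrict_mem measurableSet_ball)

lemma isFiniteMeasure_diskMeasure {α : ℝ} (hα : -1 < α) :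
    IsFiniteMeasure (diskMeasure α) := by
  unfold diskMeasure
  refine isFiniteMeasure_withDensity_ofReal (Integrable.hasFiniteIntegral ?_)
  change IntegrableOn (fun z : ℂ => (fun r : ℝ => (α + 1) / Real.pi * (1 - r ^ 2) ^ α) ‖z‖) _ _
  refine (integrableOn_fun_norm_addHaar volume
    (f := fun r : ℝ => (α + 1) / Real.pi * (1 - r ^ 2) ^ α)).2 ?_
  rw [Complex.finrank_real_complex]
  have h1 : IntervalIntegrable (fun x : ℝ => x ^ α) volume 0 1 :=
    intervalIntegral.intervalIntegrable_rpow' hα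
  have h2 : IntervalIntegrable (fun x : ℝ => (1 - x) ^ α) volume 0 1 := by
    simpa using (h1.comp_sub_left 1).symm
  have h3 : IntervalIntegrable
      (fun x : ℝ => (1 - x) ^ α * (x * ((α + 1) / Real.pi * (1 + x) ^ α))) volume 0 1 := by
    refine h2.mul_continuousOn ?_
    refine continuousOn_id.mul (continuousOn_const.mul
      ((continuousOn_const.add continuousOn_id).rpow_const fun x hx => Or.inl ?_))
    rw [Set.uIcc_of_le zero_le_one] at hx
    have h0 : 0 ≤ x := hx.1
    change (1 + x : ℝ) ≠ 0
    positivity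
  rw [intervalIntegrable_iff_integrableOn_Ioo_of_le zero_le_one] at h3
  refine h3.congr_fun (fun x hx => ?_) measurableSet_Ioo
  have e : (1 - x ^ 2 : ℝ) = (1 - x) * (1 + x) := by ring
  simp only [e, smul_eq_mul, Real.mul_rpow (sub_nonneg.2 hx.2.le) (by linarith [hx.1] : 0 ≤ 1 + x)]
  ring

/-! ### Polyanalytic functions and their weighted Bergman spaces -/

/-- The Wirtinger operator `∂/∂z̄ = (1/2) (∂/∂x + i ∂/∂y)`. -/
def dbar (f : ℂ → ℂ) (z : ℂ) : ℂ :=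
  (1 / 2 : ℂ) * (fderiv ℝ f z 1 + Complex.I * fderiv ℝ f z Complex.I)

/-- `f` is `n`-analytic on the unit disk: it is of class `C^n` there and `(∂/∂z̄)^n f = 0`. -/
def IsPolyanalytic (n : ℕ) (f : ℂ → ℂ) : Prop :=
  ContDiffOn ℝ n f unitDisk ∧ ∀ z ∈ unitDisk, (dbar^[n] f) z = 0

lemma dbar_congr {f g : ℂ → ℂ} (h : Set.EqOn f g unitDisk) :
    Set.EqOn (dbar f) (dbar g) unitDisk := by
  intro z hz
  have : f =ᶠ[nhds z] g := h.eventuallyEq_of_mem (Metric.isOpen_ball.mem_nhds hz)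
  simp only [dbar, this.fderiv_eq]

lemma dbar_iterate_congr (n : ℕ) {f g : ℂ → ℂ} (h : Set.EqOn f g unitDisk) :
    Set.EqOn (dbar^[n] f) (dbar^[n] g) unitDisk := by
  induction n generalizing f g with
  | zero => exact h
  | succ n ih => exact ih (dbar_congr h)

lemma contDiffOn_dbar {n : ℕ} {f : ℂ → ℂ} (hf : ContDiffOn ℝ (n + 1 : ℕ) f unitDisk) :
    ContDiffOn ℝ n (dbar f) unitDisk := by
  have h1 : ContDiffOn ℝ n (fderiv ℝ f) unitDisk :=
    hf.fderiv_of_isOpen Metric.isOpen_ball (by norm_cast)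
  unfold dbar
  exact contDiffOn_const.mul ((h1.clm_apply contDiffOn_const).add
    (contDiffOn_const.mul (h1.clm_apply contDiffOn_const)))

lemma dbar_iterate_add (n : ℕ) {f g : ℂ → ℂ} (hf : ContDiffOn ℝ n f unitDisk)
    (hg : ContDiffOn ℝ n g unitDisk) :
    Set.EqOn (dbar^[n] (f + g)) (dbar^[n] f + dbar^[n] g) unitDisk := by
  induction n generalizing f g with
  | zero => intro z _; rfl
  | succ n ih =>
    have key : Set.EqOn (dbar (f + g)) (dbar f + dbar g) unitDisk := by
      intro z hz
      have hz' := Metric.isOpen_ball.mem_nhds hz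
      have h1 : DifferentiableAt ℝ f z :=
        ((hf.differentiableOn (by norm_cast)) z hz).differentiableAt hz'
      have h2 : DifferentiableAt ℝ g z :=
        ((hg.differentiableOn (by norm_cast)) z hz).differentiableAt hz'
      simp only [dbar, fderiv_add h1 h2, Pi.add_apply, add_apply]
      ring
    exact (dbar_iterate_congr n key).trans (ih (contDiffOn_dbar hf) (contDiffOn_dbar hg))

lemma dbar_const_smul (c : ℂ) (f : ℂ → ℂ) : dbar (c • f) = c • dbar f := by
  funext z
  simp only [dbar, fderiv_const_smul_field, Pi.smul_apply, smul_apply,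
    smul_eq_mul]
  ring

lemma dbar_iterate_const_smul (n : ℕ) (c : ℂ) (f : ℂ → ℂ) :
    dbar^[n] (c • f) = c • dbar^[n] f := by
  induction n generalizing f with
  | zero => rfl
  | succ n ih => rw [Function.iterate_succ_apply, dbar_const_smul, ih]; rfl

lemma IsPolyanalytic.add {n : ℕ} {f g : ℂ → ℂ} (hf : IsPolyanalytic n f)
    (hg : IsPolyanalytic n g) : IsPolyanalytic n (f + g) := by
  refine ⟨hf.1.add hg.1, fun z hz => ?_⟩
  rw [dbar_iterate_add n hf.1 hg.1 hz, Pi.add_apply, hf.2 z hz, hg.2 z hz, add_zero]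

lemma IsPolyanalytic.const_smul {n : ℕ} {f : ℂ → ℂ} (c : ℂ) (hf : IsPolyanalytic n f) :
    IsPolyanalytic n (c • f) := by
  refine ⟨hf.1.const_smul c, fun z hz => ?_⟩
  rw [dbar_iterate_const_smul, Pi.smul_apply, hf.2 z hz, smul_zero]

lemma dbar_zero : dbar (0 : ℂ → ℂ) = 0 := by
  simpa using dbar_const_smul 0 0

lemma isPolyanalytic_zero (n : ℕ) : IsPolyanalytic n (0 : ℂ → ℂ) := by
  refine ⟨contDiffOn_const, fun z _ => ?_⟩
  have := dbar_iterate_const_smul n 0 0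
  simp only [zero_smul] at this
  rw [this]; rfl

/-- The weighted Bergman space of `n`-analytic functions on the unit disk: the square integrable
`n`-analytic functions, with the norm of the ambient `L²` space. -/
def bergman (n : ℕ) (α : ℝ) : Submodule ℂ (L2 α) where
  carrier := {f | ∃ g : ℂ → ℂ, IsPolyanalytic n g ∧ f =ᵐ[diskMeasure α] g}
  zero_mem' := ⟨0, isPolyanalytic_zero n, Lp.coeFn_zero _ _ _⟩
  add_mem' := by
    rintro f₁ f₂ ⟨g₁, h₁, e₁⟩ ⟨g₂, h₂, e₂⟩
    exact ⟨g₁ + g₂, h₁.add h₂, (Lp.coeFn_add _ _).trans (e₁.add e₂)⟩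
  smul_mem' := by
    rintro c f ⟨g, h, e⟩
    exact ⟨c • g, h.const_smul c, (Lp.coeFn_smul _ _).trans (e.const_smul c)⟩

/-! ### Rotations and radial operators -/

lemma measurePreserving_rotation (α : ℝ) (τ : Circle) :
    MeasurePreserving (fun z : ℂ => ((τ⁻¹ : Circle) : ℂ) * z) (diskMeasure α) (diskMeasure α) := by
  have h : ∀ c : Circle,
      MeasurePreserving (fun z : ℂ => (c : ℂ) * z) (diskMeasure α) (diskMeasure α) := by
    intro c
    have hv : MeasurePreserving (fun z : ℂ => (c : ℂ) * z) volume volume :=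
      (_root_.rotation c).measurePreserving
    have hm : Measurable fun z : ℂ =>
        ENNReal.ofReal ((α + 1) / Real.pi * (1 - ‖z‖ ^ 2) ^ α) := by fun_prop
    refine ⟨by fun_prop, Measure.ext fun s hs => ?_⟩
    have hs' : MeasurableSet ((fun z : ℂ => (c : ℂ) * z) ⁻¹' s) := hs.preimage (by fun_prop)
    rw [Measure.map_apply (by fun_prop) hs]
    simp only [diskMeasure]
    rw [withDensity_apply _ hs, withDensity_apply _ hs', Measure.restrict_restrict hs,
      Measure.restrict_restrict hs',
      ← hv.setLIntegral_comp_preimage (hs.inter measurableSet_ball) hm]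
    congr 1
    · congr 1
      ext z
      simp [Circle.norm_coe]
    · funext z
      simp [Circle.norm_coe]
  exact h τ⁻¹

/-- The rotation operator `(ρ(τ) f)(z) = f(τ⁻¹ z)` on the weighted `L²` space. -/
def rotation (α : ℝ) (τ : Circle) : L2 α →L[ℂ] L2 α :=
  (Lp.compMeasurePreservingₗᵢ ℂ (fun z : ℂ => ((τ⁻¹ : Circle) : ℂ) * z)
    (measurePreserving_rotation α τ)).toContinuousLinearMap

lemma rotation_coeFn (α : ℝ) (τ : Circle) (f : L2 α) :
    rotation α τ f =ᵐ[diskMeasure α] fun z => f (((τ⁻¹ : Circle) : ℂ) * z) :=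
  Lp.coeFn_compMeasurePreserving f (measurePreserving_rotation α τ)

lemma IsPolyanalytic.comp_rotation {n : ℕ} {f : ℂ → ℂ} (hf : IsPolyanalytic n f) (c : Circle) :
    IsPolyanalytic n (fun z => f ((c : ℂ) * z)) := by
  have key : ∀ g : ℂ → ℂ, dbar (fun z => g ((c : ℂ) * z)) =
      (conj (c : ℂ)) • fun z => dbar g ((c : ℂ) * z) := by
    intro g
    funext z
    have h := (_root_.rotation c).toContinuousLinearEquiv.comp_right_fderiv (f := g) (x := z)
    have h' : fderiv ℝ (fun z => g ((c : ℂ) * z)) z =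
        (fderiv ℝ g ((c : ℂ) * z)).comp
          ((_root_.rotation c).toContinuousLinearEquiv : ℂ →L[ℝ] ℂ) := h
    have e : ∀ (L : ℂ →L[ℝ] ℂ) (w : ℂ), L w = w.re * L 1 + w.im * L Complex.I := by
      intro L w
      have hw : w = w.re • (1 : ℂ) + w.im • Complex.I := by simp [Complex.re_add_im]
      conv_lhs => rw [hw]
      rw [map_add, map_smul, map_smul, Complex.real_smul, Complex.real_smul]
    have ev : ∀ v : ℂ, fderiv ℝ (fun z => g ((c : ℂ) * z)) z v =
        fderiv ℝ g ((c : ℂ) * z) ((c : ℂ) * v) := fun v => by rw [h']; rfl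
    have hconj : conj (c : ℂ) = ((c : ℂ).re : ℂ) - (c : ℂ).im * Complex.I := by
      apply Complex.ext <;> simp
    simp only [dbar, Pi.smul_apply, smul_eq_mul]
    rw [ev, ev, e _ ((c : ℂ) * 1), e _ ((c : ℂ) * Complex.I), hconj]
    simp only [mul_one, Complex.mul_I_re, Complex.mul_I_im]
    push_cast
    linear_combination (1 / 2 * ((c : ℂ).im : ℂ) *
      fderiv ℝ g ((c : ℂ) * z) Complex.I) * Complex.I_sq
  have key' : ∀ (m : ℕ) (g : ℂ → ℂ), dbar^[m] (fun z => g ((c : ℂ) * z)) =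
      (conj (c : ℂ)) ^ m • fun z => (dbar^[m] g) ((c : ℂ) * z) := by
    intro m
    induction m with
    | zero => intro g; simp
    | succ m ih =>
      intro g
      rw [Function.iterate_succ_apply, key, dbar_iterate_const_smul, ih, smul_smul, pow_succ']
      rfl
  have hmaps : Set.MapsTo (fun z : ℂ => (c : ℂ) * z) unitDisk unitDisk := by
    intro z hz
    simpa [Circle.norm_coe] using hz
  refine ⟨hf.1.comp (contDiff_const.mul contDiff_id).contDiffOn hmaps, fun z hz => ?_⟩
  rw [key', Pi.smul_apply, hf.2 _ (hmaps hz), smul_zero]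

lemma rotation_mem_bergman (n : ℕ) (α : ℝ) (τ : Circle) {f : L2 α} (hf : f ∈ bergman n α) :
    rotation α τ f ∈ bergman n α := by
  obtain ⟨g, hg, e⟩ := hf
  exact ⟨_, hg.comp_rotation τ⁻¹, (rotation_coeFn α τ f).trans
    ((measurePreserving_rotation α τ).quasiMeasurePreserving.ae_eq_comp e)⟩

/-- The rotation operator on the Bergman space of `n`-analytic functions. -/
def bergmanRotation (n : ℕ) (α : ℝ) (τ : Circle) : bergman n α →L[ℂ] bergman n α :=
  (rotation α τ).restrict fun _ hf => rotation_mem_bergman n α τ hf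

/-- The radial operators on the Bergman space of `n`-analytic functions: the bounded operators
that commute with all rotations. -/
def radialOperators (n : ℕ) (α : ℝ) : Set (bergman n α →L[ℂ] bergman n α) :=
  {S | ∀ τ : Circle, bergmanRotation n α τ * S = S * bergmanRotation n α τ}

/-! ### Monomials, truncated frequency subspaces and disk polynomials -/

/-- The monomial function `z ^ p * z̄ ^ q`. -/
def monomial (p q : ℕ) (z : ℂ) : ℂ := z ^ p * conj z ^ q

lemma memLp_monomial {α : ℝ} (hα : -1 < α) (p q : ℕ) :
    MemLp (monomial p q) 2 (diskMeasure α) := by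
  have := isFiniteMeasure_diskMeasure hα
  refine MemLp.of_bound (C := 1) ?_ ?_
  · have : Continuous (monomial p q) := by unfold monomial; fun_prop
    exact this.aestronglyMeasurable
  · filter_upwards [ae_mem_unitDisk α] with z hz
    have hz' : ‖z‖ ≤ 1 := by simpa using (Metric.mem_ball.1 hz).le
    simp only [monomial, norm_mul, norm_pow, RCLike.norm_conj]
    exact mul_le_one₀ (pow_le_one₀ (norm_nonneg _) hz') (by positivity)
      (pow_le_one₀ (norm_nonneg _) hz')

/-- The truncated frequency subspace: the span, in the weighted `L²` space, of the monomials
`z ^ p * z̄ ^ q` with `p - q = ξ` and `min p q < s`. -/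
def truncFreq {α : ℝ} (hα : -1 < α) (ξ : ℤ) (s : ℕ) : Submodule ℂ (L2 α) :=
  Submodule.span ℂ {f | ∃ p q : ℕ, (p : ℤ) - q = ξ ∧ min p q < s ∧
    f = (memLp_monomial hα p q).toLp (monomial p q)}

/-- The normalized disk polynomial (Jacobi polynomial in `z` and `z̄`) with indices `p`, `q`. -/
def diskPoly (α : ℝ) (p q : ℕ) (z : ℂ) : ℂ :=
  (Real.sqrt ((α + p + q + 1) * p.factorial * q.factorial /
      ((α + 1) * Real.Gamma (α + p + 1) * Real.Gamma (α + q + 1))) : ℂ) *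
    ∑ k ∈ Finset.range (min p q + 1),
      (((-1) ^ k * Real.Gamma (α + p + q + 1 - k) /
        (k.factorial * (p - k).factorial * (q - k).factorial) : ℝ) : ℂ) *
        monomial (p - k) (q - k) z

lemma memLp_diskPoly {α : ℝ} (hα : -1 < α) (p q : ℕ) :
    MemLp (diskPoly α p q) 2 (diskMeasure α) := by
  unfold diskPoly
  exact (memLp_finsetSum _ fun k _ => (memLp_monomial hα _ _).const_mul _).const_mul _

/-- The normalized disk polynomial as an element of the weighted `L²` space. -/
def diskPolyLp {α : ℝ} (hα : -1 < α) (p q : ℕ) : L2 α :=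
  (memLp_diskPoly hα p q).toLp (diskPoly α p q)

instance finiteDimensional_truncFreq {α : ℝ} (hα : -1 < α) (ξ : ℤ) (s : ℕ) :
    FiniteDimensional ℂ (truncFreq hα ξ s) := by
  refine FiniteDimensional.span_of_finite ℂ 
    ((((Set.finite_Iio (s + ξ.natAbs)).prod (Set.finite_Iio (s + ξ.natAbs))).image
      fun x : ℕ × ℕ => (memLp_monomial hα x.1 x.2).toLp (monomial x.1 x.2)).subset ?_)
  rintro f ⟨p, q, h1, h2, rfl⟩
  exact ⟨(p, q), ⟨Set.mem_Iio.2 (by omega), Set.mem_Iio.2 (by omega)⟩, rfl⟩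

instance completeSpace_truncFreq {α : ℝ} (hα : -1 < α) (ξ : ℤ) (s : ℕ) :
    CompleteSpace (truncFreq hα ξ s) :=
  FiniteDimensional.complete ℂ _

/-- The frequencies `ξ ≥ -n + 1`. -/
abbrev Freq (n : ℕ) : Type := {ξ : ℤ // -(n : ℤ) + 1 ≤ ξ}

/-- The number `min {n, n + ξ}`, which is positive for `ξ ≥ -n + 1`. -/
def blockSize {n : ℕ} (ξ : Freq n) : ℕ := (min (n : ℤ) (n + ξ.1)).toNat

/-- The subspace with frequency `ξ` and truncation `min {n, n + ξ}`. -/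
abbrev freqBlock (n : ℕ) {α : ℝ} (hα : -1 < α) (ξ : Freq n) : Submodule ℂ (L2 α) :=
  truncFreq hα ξ.1 (blockSize ξ)

lemma isPolyanalytic_monomial {n p q : ℕ} (hq : q < n) : IsPolyanalytic n (monomial p q) := by
  have hd : ∀ p q : ℕ, dbar (monomial p q) = (q : ℂ) • monomial p (q - 1) := by
    intro p q
    funext z
    have h1 : HasFDerivAt (𝕜 := ℝ) (fun z : ℂ => z ^ p) _ z := (hasFDerivAt_id z).pow p
    have h2 : HasFDerivAt (𝕜 := ℝ) (fun z : ℂ => (conj z) ^ q) _ z :=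
      (Complex.conjCLE.toContinuousLinearMap.hasFDerivAt (x := z)).pow q
    have h3 : fderiv ℝ (monomial p q) z = _ := (h1.mul h2).fderiv
    simp only [dbar, h3]
    simp [monomial]
    linear_combination (1 / 2 * conj z ^ q * p * z ^ (p - 1) -
      1 / 2 * z ^ p * q * conj z ^ (q - 1)) * Complex.I_sq
  have hi : ∀ m q : ℕ, q < m → dbar^[m] (monomial p q) = 0 := by
    intro m
    induction m with
    | zero => intro q h; omega
    | succ m ih =>
      intro q h
      rw [Function.iterate_succ_apply, hd, dbar_iterate_const_smul]
      rcases q with _ | q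
      · simp
      · rw [Nat.add_sub_cancel, ih q (by omega), smul_zero]
  refine ⟨?_, fun z _ => by rw [hi n q hq]; rfl⟩
  exact ((contDiff_id.pow p).mul
    (Complex.conjCLE.toContinuousLinearMap.contDiff.pow q)).contDiffOn

lemma freqBlock_le_bergman (n : ℕ) {α : ℝ} (hα : -1 < α) (ξ : Freq n) :
    freqBlock n hα ξ ≤ bergman n α := by
  refine Submodule.span_le.2 ?_
  rintro f ⟨p, q, h1, h2, rfl⟩
  have := ξ.2
  unfold blockSize at h2
  exact ⟨monomial p q, isPolyanalytic_monomial (by omega), MemLp.coeFn_toLp _⟩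

/-- The C*-algebra of bounded operators on the block with frequency `ξ`. -/
def BlockOp (n : ℕ) {α : ℝ} (hα : -1 < α) (ξ : Freq n) : Type :=
  freqBlock n hα ξ →L[ℂ] freqBlock n hα ξ

instance instCStarAlgebraBlockOp (n : ℕ) {α : ℝ} (hα : -1 < α) (ξ : Freq n) :
    CStarAlgebra (BlockOp n hα ξ) :=
  inferInstanceAs (CStarAlgebra (freqBlock n hα ξ →L[ℂ] freqBlock n hα ξ))

/-- An element of `BlockOp` as a function on the block. -/
def BlockOp.apply {n : ℕ} {α : ℝ} {hα : -1 < α} {ξ : Freq n} (B : BlockOp n hα ξ)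
    (f : freqBlock n hα ξ) : freqBlock n hα ξ :=
  (show freqBlock n hα ξ →L[ℂ] freqBlock n hα ξ from B) f

/-- The direct sum of the algebras of bounded operators on the blocks: the norm bounded sequences
of operators, with componentwise operations and the supremum norm. -/
abbrev BlockOpSum (n : ℕ) {α : ℝ} (hα : -1 < α) : Type := lp (fun ξ : Freq n => BlockOp n hα ξ) ∞

/-! ### The direct sum of matrix algebras -/

/-- The indices `q` with `max {0, -ξ} ≤ q ≤ n - 1`, which enumerate the components of the vectors
and matrices of order `min {n, n + ξ}`. -/
abbrev BlockIndex {n : ℕ} (ξ : Freq n) : Type := {q : Fin n // 0 ≤ (q : ℤ) + ξ.1}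

lemma card_blockIndex {n : ℕ} (ξ : Freq n) : Fintype.card (BlockIndex ξ) = blockSize ξ := by
  have h := ξ.2
  unfold blockSize
  have e : BlockIndex ξ ≃ Fin (min (n : ℤ) (n + ξ.1)).toNat :=
    { toFun := fun q => ⟨q.1 - (-ξ.1).toNat, by have := q.2; have := q.1.2; omega⟩
      invFun := fun k => ⟨⟨k + (-ξ.1).toNat, by have := k.2; omega⟩, by
        have := k.2
        simp only
        omega⟩
      left_inv := fun q => by
        have := q.2
        apply Subtype.ext
        apply Fin.ext
        simp only
        omega
      right_inv := fun k => by
        apply Fin.ext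
        simp }
  rw [Fintype.card_congr e, Fintype.card_fin]

/-- The Hilbert space direct sum of the spaces `ℂ ^ min {n, n + ξ}` over `ξ ≥ -n + 1`. -/
abbrev SeqSpace (n : ℕ) : Type := lp (fun ξ : Freq n => EuclideanSpace ℂ (BlockIndex ξ)) 2

/-- The direct sum of the matrix algebras of order `min {n, n + ξ}` over `ξ ≥ -n + 1`: the
sequences of matrices with bounded operator norms, with componentwise operations and the supremum
norm. -/
abbrev MatrixSum (n : ℕ) : Type := lp (fun ξ : Freq n => Matrix (BlockIndex ξ) (BlockIndex ξ) ℂ) ∞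

/-- The bounded operator `T` acts on the sequence space as the matrix sequence `A`. -/
def ActsAs {n : ℕ} (A : MatrixSum n) (T : SeqSpace n →L[ℂ] SeqSpace n) : Prop :=
  ∀ (v : SeqSpace n) (ξ : Freq n) (j : BlockIndex ξ), T v ξ j = ∑ k, A ξ j k * v ξ k

/-- The direct sum of matrix algebras, seen as a set of bounded operators. -/
def matrixOperators (n : ℕ) : Set (SeqSpace n →L[ℂ] SeqSpace n) :=
  {T | ∃ A : MatrixSum n, ActsAs A T}

/-- The operator `U S U*` for a unitary operator `U`. -/
def conjOp {n : ℕ} {α : ℝ} (U : bergman n α ≃ₗᵢ[ℂ] SeqSpace n)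
    (S : bergman n α →L[ℂ] bergman n α) : SeqSpace n →L[ℂ] SeqSpace n :=
  (U.toContinuousLinearEquiv : bergman n α →L[ℂ] SeqSpace n) ∘L S ∘L
    (U.symm.toContinuousLinearEquiv : SeqSpace n →L[ℂ] bergman n α)

end PolyBergman

end

open PolyBergman

/-!
The rotations act on a monomial `z ^ p * z̄ ^ q` by the character `τ ^ (q - p)`. Hence the Bergman
space of `n`-analytic functions decomposes according to the frequency `ξ = p - q`, and an operator
commutes with all rotations if and only if it preserves each of the joint eigenspaces, which are
the finite dimensional blocks `freqBlock n hα ξ`. The radial operators are then exactly the block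
diagonal ones, and everything follows from a description of such operators on a Hilbert sum.

* `IsHilbertSum.exists_starAlgEquiv_lp`: on a Hilbert sum, a star algebra that consists of the
  operators preserving the summands is isometrically the `ℓ^∞` sum of the operator algebras of the
  summands. It is applied to the blocks themselves, and to the same blocks in the coordinates given
  by the disk polynomials.
* `bergman_eq_closure`: the Bergman space is the closed span of the blocks. The inclusion of the
  closed span, which also gives completeness, is `mem_bergman_of_hasSum`: by
  `exists_norm_coeff_mul_pow_le` the coefficients in the block with frequency `ξ` are bounded by
  `K * R ^ (-ξ)` times the norm, for every `R < 1`, so that an `L²` convergent sum of functions of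
  the blocks is a polynomial in `z̄` whose coefficients are power series converging in the disk. For
  density, an `n`-analytic function is a polynomial in `z̄` with holomorphic coefficients
  (`IsPolyanalytic.exists_eq_sum`); integrating their power series over smaller disks shows that a
  function orthogonal to all blocks vanishes.
* `orthonormal_diskPolyLp`: the disk polynomials are orthonormal. The moments of the measure are
  Beta integrals, and the sum that gives the inner product with a monomial of the same frequency is
  evaluated by Lagrange interpolation at the nodes `0, …, min p q` (`sum_neg_one_pow_div_sub`).
* `radialAlgebra`: the set of rotations is closed under adjoints, so its commutant is a von Neumann
  algebra.
-/

/-! ### Block diagonal operators on a Hilbert sum -/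

section HilbertSum

open ContinuousLinearMap

variable {ι E : Type*} [NormedAddCommGroup E] [InnerProductSpace ℂ E] [CompleteSpace E]
  {G : ι → Type*} [∀ i, NormedAddCommGroup (G i)] [∀ i, InnerProductSpace ℂ (G i)]
  {V : ∀ i, G i →ₗᵢ[ℂ] E}

namespace IsHilbertSum

lemma inner_linearIsometryEquiv_apply (hV : IsHilbertSum ℂ G V) (x : E) (i : ι) (y : G i) :
    inner ℂ y (hV.linearIsometryEquiv x i) = inner ℂ (V i y) x := by
  classical
  rw [← lp.inner_single_left, ← hV.linearIsometryEquiv.symm.inner_map_map,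
    LinearIsometryEquiv.symm_apply_apply, hV.linearIsometryEquiv_symm_apply_single]

lemma hasSum_linearIsometryEquiv (hV : IsHilbertSum ℂ G V) (x : E) :
    HasSum (fun i => V i (hV.linearIsometryEquiv x i)) x := by
  simpa using hV.hasSum_linearIsometryEquiv_symm (hV.linearIsometryEquiv x)

/-- Bounded operators on a Hilbert sum are determined by their values on the summands. -/
lemma clm_ext (hV : IsHilbertSum ℂ G V) {S T : E →L[ℂ] E}
    (h : ∀ i x, S (V i x) = T (V i x)) : S = T := by
  ext x
  have h1 := (hV.hasSum_linearIsometryEquiv x).mapL S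
  have h2 := (hV.hasSum_linearIsometryEquiv x).mapL T
  simp only [h] at h1
  exact h1.unique h2

/-- A norm bounded family of operators on the summands is the diagonal of an operator on the
Hilbert sum, with the same bound. -/
lemma exists_blockDiagonal (hV : IsHilbertSum ℂ G V) (B : ∀ i, G i →L[ℂ] G i) {C : ℝ}
    (hC : 0 ≤ C) (hB : ∀ i, ‖B i‖ ≤ C) :
    ∃ T : E →L[ℂ] E, ‖T‖ ≤ C ∧ ∀ i x, T (V i x) = V i (B i x) := by
  classical
  have hle : ∀ (v : lp G 2) (i : ι), ‖B i (v i)‖ ^ (2 : ℝ≥0∞).toReal ≤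
      C ^ (2 : ℝ≥0∞).toReal * ‖v i‖ ^ (2 : ℝ≥0∞).toReal := fun v i => by
    rw [← Real.mul_rpow hC (norm_nonneg _)]
    exact Real.rpow_le_rpow (norm_nonneg _) ((B i).le_of_opNorm_le (hB i) _) (by simp)
  have h2 : 0 < (2 : ℝ≥0∞).toReal := by simp
  let D : lp G 2 →ₗ[ℂ] lp G 2 :=
    { toFun := fun v => ⟨fun i => B i (v i), memℓp_gen
        (((lp.memℓp v).summable h2).mul_left (C ^ (2 : ℝ≥0∞).toReal) |>.of_nonneg_of_le
          (fun i => by positivity) (hle v))⟩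
      map_add' := fun v w => by
        apply lp.ext
        funext i
        exact map_add (B i) (v i) (w i)
      map_smul' := fun c v => by
        apply lp.ext
        funext i
        exact map_smul (B i) c (v i) }
  have hD : ∀ v, ‖D v‖ ≤ C * ‖v‖ := fun v => by
    refine lp.norm_le_of_forall_sum_le h2 (by positivity) fun s => ?_
    rw [Real.mul_rpow hC (norm_nonneg _)]
    refine (Finset.sum_le_sum fun i _ => hle v i).trans ?_
    rw [← Finset.mul_sum]
    exact mul_le_mul_of_nonneg_left (lp.sum_rpow_le_norm_rpow h2 v s) (by positivity)
  let U := hV.linearIsometryEquiv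
  let T : E →ₗ[ℂ] E := U.symm.toLinearEquiv.toLinearMap ∘ₗ D ∘ₗ U.toLinearEquiv.toLinearMap
  have hT : ∀ x, ‖T x‖ ≤ C * ‖x‖ := fun x => by
    have := hD (U x)
    rw [U.norm_map] at this
    exact (U.symm.norm_map _).trans_le this
  refine ⟨T.mkContinuous C hT, T.mkContinuous_norm_le hC hT, fun i x => ?_⟩
  change U.symm (D (U (V i x))) = _
  rw [← hV.linearIsometryEquiv_symm_apply_single, ← hV.linearIsometryEquiv_symm_apply_single]
  change U.symm (D (U (U.symm _))) = _
  rw [U.apply_symm_apply]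
  congr 1
  apply lp.ext
  funext j
  change B j (lp.single 2 i x j) = _
  rcases eq_or_ne j i with rfl | h
  · simp
  · simp [Pi.single_eq_of_ne h]

/-- A block diagonal operator acts on the coordinates componentwise. -/
lemma linearIsometryEquiv_apply_of_blockDiagonal (hV : IsHilbertSum ℂ G V) {S : E →L[ℂ] E}
    {B : ∀ i, G i →L[ℂ] G i} (h : ∀ i x, S (V i x) = V i (B i x)) (x : E) (i : ι) :
    hV.linearIsometryEquiv (S x) i = B i (hV.linearIsometryEquiv x i) := by
  refine ext_inner_left ℂ fun y => ?_
  rw [hV.inner_linearIsometryEquiv_apply]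
  have h1 := ((hV.hasSum_linearIsometryEquiv x).mapL S).mapL (innerSL ℂ (V i y))
  simp only [h, innerSL_apply_apply] at h1
  refine h1.unique ?_
  rw [← (V i).inner_map_map]
  exact hasSum_single i fun j hj => hV.OrthogonalFamily hj.symm _ _

/-- The summands of a Hilbert sum may be replaced by isometrically isomorphic spaces. -/
lemma comp_linearIsometryEquiv {G' : ι → Type*} [∀ i, NormedAddCommGroup (G' i)]
    [∀ i, InnerProductSpace ℂ (G' i)] [∀ i, CompleteSpace (G' i)] (hV : IsHilbertSum ℂ G V)
    (e : ∀ i, G' i ≃ₗᵢ[ℂ] G i) :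
    IsHilbertSum ℂ G' fun i => (V i).comp (e i).toLinearIsometry := by
  refine IsHilbertSum.mk (fun i j hij x y => hV.OrthogonalFamily hij _ _) fun x _ => ?_
  refine mem_closure_of_tendsto (hV.hasSum_linearIsometryEquiv x)
    (Filter.Eventually.of_forall fun s => sum_mem fun i _ => Submodule.mem_iSup_of_mem i ?_)
  exact ⟨(e i).symm (hV.linearIsometryEquiv x i), by simp⟩

variable [∀ i, CompleteSpace (G i)]

/-- A star algebra that consists of the operators which leave the summands of a Hilbert sum
invariant is the algebra of norm bounded families of operators on the summands. These are encoded
as the elements of C⋆-algebras `A i` that are identified with the operators on the `i`-th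
summand. -/
theorem exists_starAlgEquiv_lp (hV : IsHilbertSum ℂ G V) (R : StarSubalgebra ℂ (E →L[ℂ] E))
    (hR : ∀ S, S ∈ R ↔ ∀ i x, ∃ y, S (V i x) = V i y)
    {A : ι → Type*} [∀ i, CStarAlgebra (A i)] (θ : ∀ i, A i ≃⋆ₐ[ℂ] (G i →L[ℂ] G i))
    (hθ : ∀ i a, ‖θ i a‖ = ‖a‖) :
    ∃ Φ : R ≃⋆ₐ[ℂ] lp A ∞, Isometry Φ ∧
      ∀ (S : R) (i : ι) (x : G i), S.1 (V i x) = V i (θ i (Φ S i) x) := by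
  -- the compression of an operator to a summand
  let c : ∀ i, (E →L[ℂ] E) → (G i →L[ℂ] G i) := fun i S =>
    adjoint (V i).toContinuousLinearMap ∘L S ∘L (V i).toContinuousLinearMap
  have hc : ∀ i S x y, S (V i x) = V i y → c i S x = y := fun i S x y h => by
    change adjoint (V i).toContinuousLinearMap (S (V i x)) = y
    rw [h]
    refine ext_inner_left ℂ fun z => ?_
    rw [adjoint_inner_right]
    exact (V i).inner_map_map z y
  have hc' : ∀ (S : R) i x, S.1 (V i x) = V i (c i S.1 x) := fun S i x => by
    obtain ⟨y, hy⟩ := (hR _).1 S.2 i x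
    rw [hc i S.1 x y hy, hy]
  have hnorm : ∀ i S, ‖c i S‖ ≤ ‖S‖ := fun i S => by
    have h1 : ‖(V i).toContinuousLinearMap‖ ≤ 1 := (V i).norm_toContinuousLinearMap_le
    have h2 : ‖adjoint (V i).toContinuousLinearMap‖ ≤ 1 := by
      rwa [LinearIsometryEquiv.norm_map]
    calc ‖c i S‖ ≤ ‖adjoint (V i).toContinuousLinearMap‖ *
          (‖S‖ * ‖(V i).toContinuousLinearMap‖) :=
          (opNorm_comp_le _ _).trans
            (mul_le_mul_of_nonneg_left (opNorm_comp_le _ _) (norm_nonneg _))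
      _ ≤ 1 * (‖S‖ * 1) := by gcongr
      _ = ‖S‖ := by ring
  have hinj : ∀ i {B B' : G i →L[ℂ] G i}, (∀ x, V i (B x) = V i (B' x)) → B = B' :=
    fun i B B' h => ContinuousLinearMap.ext fun x => (V i).injective (h x)
  have hsymm : ∀ i (B : G i →L[ℂ] G i), ‖(θ i).symm B‖ = ‖B‖ := fun i B => by
    rw [← hθ, StarAlgEquiv.apply_symm_apply]
  let F : R → lp A ∞ := fun S => ⟨fun i => (θ i).symm (c i S.1), memℓp_infty ⟨‖S.1‖, by
    rintro _ ⟨i, rfl⟩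
    simpa only [hsymm] using hnorm i S.1⟩⟩
  have hF : ∀ S i, θ i (F S i) = c i S.1 := fun S i => (θ i).apply_symm_apply _
  have hext : ∀ {a b : lp A ∞}, (∀ i, θ i (a i) = θ i (b i)) → a = b := fun h =>
    lp.ext (funext fun i => (θ i).injective (h i))
  have hmul : ∀ S T, F (S * T) = F S * F T := fun S T => hext fun i => by
    rw [lp.infty_coeFn_mul, Pi.mul_apply, map_mul, hF, hF, hF]
    refine hinj i fun x => ?_
    rw [← hc']
    change S.1 (T.1 (V i x)) = _
    rw [hc', hc']
    rfl
  have hadd : ∀ S T, F (S + T) = F S + F T := fun S T => hext fun i => by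
    rw [lp.coeFn_add, Pi.add_apply, map_add, hF, hF, hF]
    refine hinj i fun x => ?_
    rw [← hc', add_apply, map_add, ← hc', ← hc']
    rfl
  have hsmul : ∀ (r : ℂ) S, F (r • S) = r • F S := fun r S => hext fun i => by
    rw [lp.coeFn_smul, Pi.smul_apply, map_smul, hF, hF]
    refine hinj i fun x => ?_
    rw [← hc', smul_apply, map_smul, ← hc']
    rfl
  have hstar : ∀ S, F (star S) = star (F S) := fun S => hext fun i => by
    rw [lp.star_apply, map_star, hF, hF]
    change c i (adjoint S.1) = adjoint (c i S.1)
    simp only [c, adjoint_comp, adjoint_adjoint]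
    rfl
  have hle : ∀ S, ‖F S‖ = ‖S‖ := fun S => by
    refine le_antisymm (lp.norm_le_of_forall_le (norm_nonneg _) fun i => ?_) ?_
    · rw [← hθ, hF]
      exact hnorm i S.1
    · obtain ⟨T, hT, hT'⟩ := hV.exists_blockDiagonal (fun i => c i S.1) (norm_nonneg (F S))
        fun i => by
          rw [← hF, hθ]
          exact lp.norm_apply_le_norm (by simp) (F S) i
      have : S.1 = T := hV.clm_ext fun i x => by rw [hc', hT']
      change ‖S.1‖ ≤ _
      rwa [this]
  have hsurj : Function.Surjective F := fun a => by
    obtain ⟨T, -, hT⟩ := hV.exists_blockDiagonal (fun i => θ i (a i)) (norm_nonneg a)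
      fun i => by
        rw [hθ]
        exact lp.norm_apply_le_norm (by simp) a i
    refine ⟨⟨T, (hR T).2 fun i x => ⟨_, hT i x⟩⟩, hext fun i => ?_⟩
    rw [hF]
    ext x
    exact hc i T x _ (hT i x)
  have hinjF : Function.Injective F := fun S T h => by
    refine Subtype.ext (hV.clm_ext fun i x => ?_)
    rw [hc', hc', ← hF, ← hF, h]
  let e := Equiv.ofBijective F ⟨hinjF, hsurj⟩
  let Φ : R ≃⋆ₐ[ℂ] lp A ∞ :=
    { e with
      map_mul' := hmul
      map_add' := hadd
      map_star' := hstar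
      map_smul' := hsmul }
  refine ⟨Φ, ?_, fun S i x => ?_⟩
  · refine AddMonoidHomClass.isometry_of_norm Φ hle
  · change _ = V i (θ i (F S i) x)
    rw [hF, hc']

end IsHilbertSum

end HilbertSum

namespace PolyBergman

/-! ### Rotation invariance and moments -/

lemma exists_circle_zpow_ne_one {k : ℤ} (hk : k ≠ 0) : ∃ c : Circle, c ^ k ≠ 1 := by
  refine ⟨Circle.exp (Real.pi / k), fun h => ?_⟩
  have h1 := congrArg (fun c : Circle => (c : ℂ)) h
  have hk' : (k : ℂ) ≠ 0 := Int.cast_ne_zero.2 hk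
  have e : (k : ℂ) * (Real.pi / k * Complex.I) = Real.pi * Complex.I := by
    field_simp
  simp only [Circle.coe_zpow, Circle.coe_exp, Circle.coe_one] at h1
  push_cast at h1
  rw [← Complex.exp_int_mul, e, Complex.exp_pi_mul_I] at h1
  norm_num at h1

lemma monomial_circle_mul (c : Circle) (a b : ℕ) (z : ℂ) :
    monomial a b (c * z) = ((c ^ ((a : ℤ) - b) : Circle) : ℂ) * monomial a b z := by
  rw [zpow_sub, zpow_natCast, zpow_natCast, Circle.coe_mul, Circle.coe_inv_eq_conj,
    Circle.coe_pow, Circle.coe_pow]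
  simp only [monomial, map_mul, map_pow, mul_pow]
  ring

lemma conj_monomial_mul_monomial (a b c d : ℕ) (z : ℂ) :
    conj (monomial a b z) * monomial c d z = monomial (b + c) (a + d) z := by
  simp only [monomial, map_mul, map_pow, Complex.conj_conj, pow_add]
  ring

lemma continuous_monomial (a b : ℕ) : Continuous (monomial a b) := by
  unfold monomial
  fun_prop

lemma norm_monomial (a b : ℕ) (z : ℂ) : ‖monomial a b z‖ = ‖z‖ ^ (a + b) := by
  simp [monomial, pow_add]

lemma measurePreserving_circle_mul (α : ℝ) (c : Circle) :
    MeasurePreserving (fun z : ℂ => (c : ℂ) * z) (diskMeasure α) (diskMeasure α) := by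
  simpa using measurePreserving_rotation α c⁻¹

lemma measurePreserving_circle_mul_ball (α R : ℝ) (c : Circle) :
    MeasurePreserving (fun z : ℂ => (c : ℂ) * z)
      ((diskMeasure α).restrict (Metric.ball 0 R)) ((diskMeasure α).restrict (Metric.ball 0 R)) := by
  have h := (measurePreserving_circle_mul α c).restrict_preimage
    (measurableSet_ball (x := (0 : ℂ)) (ε := R))
  have e : (fun z : ℂ => (c : ℂ) * z) ⁻¹' Metric.ball 0 R = Metric.ball 0 R := by
    ext z
    simp [Circle.norm_coe]
  rwa [e] at h

/-- A rotation multiplies the monomial by a character, which is nontrivial for `a ≠ b`. -/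
lemma integral_monomial_eq_zero {ν : Measure ℂ}
    (hν : ∀ c : Circle, MeasurePreserving (fun z : ℂ => (c : ℂ) * z) ν ν) {a b : ℕ} (hab : a ≠ b) :
    ∫ z, monomial a b z ∂ν = 0 := by
  obtain ⟨c, hc⟩ := exists_circle_zpow_ne_one (k := (a : ℤ) - b) (by omega)
  have h : ∫ z, monomial a b ((c : ℂ) * z) ∂ν = ∫ z, monomial a b z ∂ν :=
    (hν c).integral_comp (_root_.rotation c).toHomeomorph.measurableEmbedding _
  simp only [monomial_circle_mul, integral_const_mul] at h
  have h' : (((c ^ ((a : ℤ) - b) : Circle) : ℂ) - 1) * ∫ z, monomial a b z ∂ν = 0 := by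
    rw [sub_mul, h, one_mul, sub_self]
  refine (mul_eq_zero.1 h').resolve_left fun h0 => hc ?_
  exact Circle.ext (by simpa using sub_eq_zero.1 h0)

/-- The integral of `|z| ^ (2 * m)` with respect to the weighted measure. -/
noncomputable def moment (α : ℝ) (m : ℕ) : ℝ :=
  (α + 1) * m.factorial * Real.Gamma (α + 1) / Real.Gamma (α + m + 2)

lemma integral_rpow_mul_one_sub_rpow {α : ℝ} (hα : -1 < α) (m : ℕ) :
    ∫ t in Set.Ioo (0 : ℝ) 1, t ^ m * (1 - t) ^ α =
      m.factorial * Real.Gamma (α + 1) / Real.Gamma (α + m + 2) := by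
  have h := ProbabilityTheory.beta_eq_betaIntegralReal (m + 1) (α + 1) (by positivity)
    (by linarith)
  have e : ((m : ℝ) + 1 + (α + 1)) = α + m + 2 := by ring
  rw [ProbabilityTheory.beta, Real.Gamma_nat_eq_factorial, e] at h
  rw [h, Complex.betaIntegral, intervalIntegral.integral_of_le zero_le_one,
    ← integral_Ioc_eq_integral_Ioo, ← RCLike.re_to_complex, ← integral_re]
  · refine setIntegral_congr_fun measurableSet_Ioc fun x ⟨hx1, hx2⟩ ↦ ?_
    have e1 : ((x : ℂ) ^ ((((m : ℝ) + 1 : ℝ) : ℂ) - 1)) = ((x ^ m : ℝ) : ℂ) := by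
      push_cast
      rw [add_sub_cancel_right, Complex.cpow_natCast]
    have e2 : ((1 - (x : ℂ)) ^ (((α + 1 : ℝ) : ℂ) - 1)) = (((1 - x) ^ α : ℝ) : ℂ) := by
      rw [Complex.ofReal_cpow (by linarith)]
      push_cast
      rw [add_sub_cancel_right]
    simp only [e1, e2, ← Complex.ofReal_mul, RCLike.re_to_complex, Complex.ofReal_re]
  · have := Complex.betaIntegral_convergent (u := ((m : ℝ) + 1 : ℝ)) (v := (α + 1 : ℝ))
      (by simp; positivity) (by simp; linarith)
    rwa [intervalIntegrable_iff_integrableOn_Ioc_of_le (by simp), IntegrableOn] at this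

lemma integral_monomial_self {α : ℝ} (hα : -1 < α) (m : ℕ) :
    ∫ z, monomial m m z ∂(diskMeasure α) = moment α m := by
  have hm : Measurable fun z : ℂ =>
      ENNReal.ofReal ((α + 1) / Real.pi * (1 - ‖z‖ ^ 2) ^ α) := by fun_prop
  let g : ℝ → ℝ := fun t => (Set.Iio (1 : ℝ)).indicator (fun t => t ^ m * (1 - t) ^ α) t
  have h0 : ∀ z : ℂ, monomial m m z = ((‖z‖ ^ 2) ^ m : ℝ) := fun z => by
    simp only [monomial]
    rw [← mul_pow, Complex.mul_conj, Complex.normSq_eq_norm_sq, ← Complex.ofReal_pow]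
  have h1 : ∫ z, monomial m m z ∂(diskMeasure α) =
      ((∫ z : ℂ, (α + 1) / Real.pi * g (‖z‖ ^ 2) : ℝ) : ℂ) := by
    rw [diskMeasure, integral_withDensity_eq_integral_toReal_smul hm
      (Filter.Eventually.of_forall fun _ => ENNReal.ofReal_lt_top), ← integral_complex_ofReal,
      ← integral_indicator measurableSet_ball]
    congr 1
    funext z
    by_cases hz : z ∈ unitDisk
    · have hz1 : ‖z‖ < 1 := by simpa using hz
      have hz2 : ‖z‖ ^ 2 < 1 := by nlinarith [norm_nonneg z]
      have hw : 0 ≤ (α + 1) / Real.pi * (1 - ‖z‖ ^ 2) ^ α := by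
        have : 0 ≤ 1 - ‖z‖ ^ 2 := by linarith
        have : 0 < α + 1 := by linarith
        positivity
      rw [Set.indicator_of_mem hz, ENNReal.toReal_ofReal hw, h0]
      simp only [g, Set.indicator_of_mem (Set.mem_Iio.2 hz2), Complex.real_smul]
      push_cast
      ring
    · have hz1 : 1 ≤ ‖z‖ := by simpa using hz
      have hz2 : ¬ ‖z‖ ^ 2 < 1 := by nlinarith
      rw [Set.indicator_of_notMem hz]
      simp [g, hz2]
  have h2 := integral_fun_norm_addHaar (volume : Measure ℂ)
    (fun r : ℝ => (α + 1) / Real.pi * g (r ^ 2))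
  have h3 := integral_comp_rpow_Ioi_of_pos (g := g) (p := 2) two_pos
  have h4 : ∫ t in Set.Ioi (0 : ℝ), g t = ∫ t in Set.Ioo (0 : ℝ) 1, t ^ m * (1 - t) ^ α := by
    rw [setIntegral_indicator measurableSet_Iio]
    rfl
  have h5 : ∫ r in Set.Ioi (0 : ℝ), r ^ (Module.finrank ℝ ℂ - 1) • ((α + 1) / Real.pi * g (r ^ 2)) =
      (α + 1) / Real.pi / 2 * ∫ x in Set.Ioi (0 : ℝ), (2 * x ^ ((2 : ℝ) - 1)) • g (x ^ (2 : ℝ)) := by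
    rw [← integral_const_mul]
    refine setIntegral_congr_fun measurableSet_Ioi fun x _ => ?_
    have e : (2 : ℝ) - 1 = 1 := by norm_num
    simp only [Complex.finrank_real_complex, smul_eq_mul, e, Real.rpow_one, Real.rpow_two]
    ring
  rw [h1, h2, h5, h3, h4, integral_rpow_mul_one_sub_rpow hα, Measure.real, Complex.volume_ball,
    Complex.finrank_real_complex, moment]
  congr 1
  simp only [ENNReal.ofReal_one, one_pow, one_mul, ENNReal.coe_toReal, NNReal.coe_real_pi,
    nsmul_eq_mul, smul_eq_mul, Nat.cast_ofNat]
  field_simp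

/-- The class of the monomial `z ^ p * z̄ ^ q` in the weighted `L²` space. -/
noncomputable def monomialLp {α : ℝ} (hα : -1 < α) (p q : ℕ) : L2 α :=
  (memLp_monomial hα p q).toLp (monomial p q)

lemma inner_monomialLp {α : ℝ} (hα : -1 < α) (a b c d : ℕ) :
    inner ℂ (monomialLp hα a b) (monomialLp hα c d) =
      if a + d = b + c then (moment α (a + d) : ℂ) else 0 := by
  have h : inner ℂ (monomialLp hα a b) (monomialLp hα c d) =
      ∫ z, monomial (b + c) (a + d) z ∂(diskMeasure α) := by
    rw [L2.inner_def]
    refine integral_congr_ae ?_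
    filter_upwards [(memLp_monomial hα a b).coeFn_toLp, (memLp_monomial hα c d).coeFn_toLp]
      with z h1 h2
    rw [monomialLp, monomialLp, h1, h2, RCLike.inner_apply', conj_monomial_mul_monomial]
  rw [h]
  split_ifs with e
  · rw [← e, integral_monomial_self hα]
  · exact integral_monomial_eq_zero (measurePreserving_circle_mul α) fun h => e h.symm

/-! ### Orthonormality of the disk polynomials -/

section Combinatorics

open Polynomial Finset

lemma nodalWeight_range_natCast {q k : ℕ} (hk : k ≤ q) :
    Lagrange.nodalWeight (range (q + 1)) (fun i : ℕ => (i : ℝ)) k =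
      (-1) ^ q * ((-1) ^ k / (k.factorial * (q - k).factorial)) := by
  have e : (range (q + 1)).erase k = range k ∪ Ico (k + 1) (q + 1) := by
    ext i
    simp only [mem_erase, mem_range, mem_union, mem_Ico]
    omega
  have hd : Disjoint (range k) (Ico (k + 1) (q + 1)) := by
    rw [disjoint_left]
    intro i
    simp only [mem_range, mem_Ico]
    omega
  have h1 : ∏ i ∈ range k, ((k : ℝ) - i) = k.factorial := by
    rw [← prod_range_reflect, ← prod_range_add_one_eq_factorial]
    push_cast
    refine prod_congr rfl fun i hi => ?_
    rw [mem_range] at hi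
    have : ((k - 1 - i : ℕ) : ℝ) = k - 1 - i := by
      rw [Nat.cast_sub (by omega), Nat.cast_sub (by omega), Nat.cast_one]
    rw [this]
    ring
  have h2 : ∏ i ∈ Ico (k + 1) (q + 1), ((k : ℝ) - i) = (-1) ^ (q - k) * (q - k).factorial := by
    rw [prod_Ico_eq_prod_range, Nat.add_sub_add_right, ← prod_range_add_one_eq_factorial]
    push_cast
    rw [← card_range (q - k), ← prod_const, card_range, ← prod_mul_distrib]
    refine prod_congr rfl fun i _ => ?_
    ring
  have h3 : ((-1 : ℝ) ^ (q - k))⁻¹ = (-1) ^ q * (-1) ^ k := by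
    obtain ⟨l, rfl⟩ := Nat.exists_eq_add_of_le hk
    rw [Nat.add_sub_cancel_left, pow_add]
    rcases neg_one_pow_eq_or ℝ k with h | h <;> rcases neg_one_pow_eq_or ℝ l with h' | h' <;>
      rw [h, h'] <;> norm_num
  rw [Lagrange.nodalWeight, prod_inv_distrib, e, prod_union hd, h1, h2, mul_inv, mul_inv, h3]
  rw [div_eq_mul_inv, mul_inv]
  ring

/-- The Lagrange interpolation formula with nodes `0, …, q`, in barycentric form. -/
lemma sum_neg_one_pow_div_sub (q : ℕ) (P : ℝ[X]) (hP : P.natDegree ≤ q) {x : ℝ} (hx : q < x) :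
    ∑ k ∈ range (q + 1), (-1) ^ k / (k.factorial * (q - k).factorial : ℝ) * (P.eval (k : ℝ) / (x - k)) =
      (-1) ^ q * P.eval x / ∏ k ∈ range (q + 1), (x - k) := by
  have hpos : ∀ k ∈ range (q + 1), 0 < x - k := fun k hk => by
    have : (k : ℝ) ≤ q := Nat.cast_le.2 (Nat.lt_succ_iff.1 (mem_range.1 hk))
    linarith
  have hdeg : P.degree < #(range (q + 1)) := by
    rw [card_range]
    exact (natDegree_le_iff_degree_le.1 hP).trans_lt (by exact_mod_cast Nat.lt_succ_self q)
  have h := Lagrange.eval_interpolate_not_at_node (s := range (q + 1)) (v := fun i : ℕ => (i : ℝ))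
    (fun i => P.eval (i : ℝ)) (x := x) fun i hi => by linarith [hpos i hi]
  rw [← Lagrange.eq_interpolate (Nat.cast_injective.injOn) hdeg, Lagrange.eval_nodal] at h
  have hne : ∏ k ∈ range (q + 1), (x - k) ≠ 0 := prod_ne_zero_iff.2 fun k hk => (hpos k hk).ne'
  rw [h, mul_left_comm, mul_div_cancel_left₀ _ hne, mul_sum]
  refine sum_congr rfl fun k hk => ?_
  rw [nodalWeight_range_natCast (Nat.lt_succ_iff.1 (mem_range.1 hk)), div_eq_mul_inv _ (x - _),
    mul_assoc ((-1) ^ q), mul_assoc ((-1) ^ q), ← mul_assoc ((-1) ^ q) ((-1) ^ q)]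
  have : ((-1 : ℝ) ^ q) * (-1) ^ q = 1 := by
    rw [← mul_pow]
    norm_num
  rw [this]
  ring

lemma Gamma_add_one_eq_prod_mul {y : ℝ} (j : ℕ) (hy : (j : ℝ) < y + 1) :
    Real.Gamma (y + 1) = (∏ i ∈ range j, (y - i)) * Real.Gamma (y + 1 - j) := by
  induction j with
  | zero => simp
  | succ j ih =>
    push_cast at hy ⊢
    have e : y + 1 - j = (y - j) + 1 := by ring
    rw [ih (by linarith), prod_range_succ, e, Real.Gamma_add_one (by linarith), mul_assoc]
    congr 2
    ring_nf

lemma factorial_add_eq_mul_prod (a l : ℕ) :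
    ((a + l).factorial : ℝ) = a.factorial * ∏ i ∈ range l, ((a : ℝ) + 1 + i) := by
  induction l with
  | zero => simp
  | succ l ih =>
    rw [← add_assoc, Nat.factorial_succ, Nat.cast_mul, ih, prod_range_succ]
    push_cast
    ring

/-- After cancelling Gamma functions, the summand is the weight `(-1) ^ k / (k! * (q - k)!)` times
`P k / (x - k)` with `x = α + p + q + 1` and a polynomial `P` of degree `q`, which vanishes at `x`
for `j > 0`. -/
lemma sum_coeff_mul_moment_aux {α : ℝ} (hα : -1 < α) {p q j : ℕ} (hqp : q ≤ p) (hj : j ≤ q) :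
    ∑ k ∈ range (q + 1), (-1) ^ k * Real.Gamma (α + p + q + 1 - k) /
        (k.factorial * (p - k).factorial * (q - k).factorial) * moment α (p + q - j - k) =
      if j = 0 then (α + 1) * Real.Gamma (α + p + 1) * Real.Gamma (α + q + 1) /
        Real.Gamma (α + p + q + 2) else 0 := by
  have hqp' : (q : ℝ) ≤ p := Nat.cast_le.2 hqp
  have hj' : (j : ℝ) ≤ q := Nat.cast_le.2 hj
  set x : ℝ := α + p + q + 1 with hx
  let P : ℝ[X] := (∏ i ∈ range j, (C (x - i) - X)) * ∏ i ∈ range (q - j), (C ((p : ℝ) + 1 + i) - X)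
  have hdeg : ∀ c : ℝ, (C c - X : ℝ[X]).natDegree ≤ 1 := fun c => by
    rw [natDegree_sub, natDegree_X_sub_C]
  have hP : P.natDegree ≤ q := by
    refine natDegree_mul_le.trans ?_
    refine (Nat.add_le_add ((natDegree_prod_le _ _).trans (sum_le_sum fun i _ => hdeg _))
      ((natDegree_prod_le _ _).trans (sum_le_sum fun i _ => hdeg _))).trans ?_
    simp
    omega
  have hPe : ∀ y : ℝ, P.eval y =
      (∏ i ∈ range j, (x - y - i)) * ∏ i ∈ range (q - j), ((p : ℝ) - y + 1 + i) := fun y => by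
    simp only [P, eval_mul, eval_prod, eval_sub, eval_C, eval_X]
    congr 1
    · exact prod_congr rfl fun i _ => by ring
    · exact prod_congr rfl fun i _ => by ring
  have key := sum_neg_one_pow_div_sub q P hP (x := x) (by linarith)
  have hterm : ∀ k ∈ range (q + 1), (-1) ^ k * Real.Gamma (x - k) /
        (k.factorial * (p - k).factorial * (q - k).factorial) * moment α (p + q - j - k) =
      (α + 1) * Real.Gamma (α + 1) *
        ((-1) ^ k / (k.factorial * (q - k).factorial : ℝ) * (P.eval (k : ℝ) / (x - k))) := by
    intro k hk
    have hkq : k ≤ q := Nat.lt_succ_iff.1 (mem_range.1 hk)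
    have hkq' : (k : ℝ) ≤ q := Nat.cast_le.2 hkq
    have e1 : ((p + q - j - k : ℕ)) = (p - k) + (q - j) := by omega
    have e2 : ((p - k : ℕ) : ℝ) = (p : ℝ) - k := Nat.cast_sub (hkq.trans hqp)
    have e3 : ((q - j : ℕ) : ℝ) = (q : ℝ) - j := Nat.cast_sub hj
    have h1 : 0 < x - k := by linarith
    have h2 := Gamma_add_one_eq_prod_mul (y := x - k) j (by linarith)
    rw [Real.Gamma_add_one h1.ne'] at h2
    have e4 : α + ((p - k + (q - j) : ℕ) : ℝ) + 2 = x - k + 1 - j := by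
      rw [Nat.cast_add, e2, e3]
      ring
    have h3 : 0 < Real.Gamma (x - k + 1 - j) := Real.Gamma_pos_of_pos (by linarith)
    have h4 : Real.Gamma (x - k) =
        (∏ i ∈ range j, (x - k - i)) * Real.Gamma (x - k + 1 - j) / (x - k) := by
      rw [← h2, mul_div_cancel_left₀ _ h1.ne']
    have f1 : ((k.factorial : ℝ)) ≠ 0 := Nat.cast_ne_zero.2 k.factorial_ne_zero
    have f2 : (((p - k).factorial : ℝ)) ≠ 0 := Nat.cast_ne_zero.2 (p - k).factorial_ne_zero
    have f3 : (((q - k).factorial : ℝ)) ≠ 0 := Nat.cast_ne_zero.2 (q - k).factorial_ne_zero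
    rw [e1, moment, e4, factorial_add_eq_mul_prod, e2, h4, hPe]
    field_simp
  rw [sum_congr rfl hterm, ← mul_sum, key]
  split_ifs with h0
  · subst h0
    have h1 : P.eval x = (-1) ^ q * ∏ i ∈ range q, (α + q - i) := by
      rw [hPe, ← card_range q, ← prod_const, card_range, ← prod_mul_distrib, range_zero,
        prod_empty, one_mul, Nat.sub_zero]
      refine prod_congr rfl fun i _ => ?_
      rw [hx]
      ring
    have h2 := Gamma_add_one_eq_prod_mul (y := α + q) q (by linarith)
    have h3 := Gamma_add_one_eq_prod_mul (y := x) (q + 1) (by push_cast; linarith)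
    have e1 : α + q + 1 - q = α + 1 := by ring
    have e2 : x + 1 - (q + 1 : ℕ) = α + p + 1 := by
      push_cast
      rw [hx]
      ring
    have e3 : α + p + q + 2 = x + 1 := by
      rw [hx]
      ring
    rw [e1] at h2
    rw [e2] at h3
    have g1 : Real.Gamma (α + p + 1) ≠ 0 :=
      (Real.Gamma_pos_of_pos (by have := (Nat.cast_nonneg p : (0 : ℝ) ≤ p); linarith)).ne'
    have g2 : ∏ i ∈ range (q + 1), (x - i) ≠ 0 := by
      refine prod_ne_zero_iff.2 fun k hk => ?_
      have : (k : ℝ) ≤ q := Nat.cast_le.2 (Nat.lt_succ_iff.1 (mem_range.1 hk))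
      linarith
    have g3 : ((-1 : ℝ) ^ q) * (-1) ^ q = 1 := by
      rw [← mul_pow]
      norm_num
    rw [h1, ← mul_assoc, g3, one_mul, e3, h3, h2]
    field_simp
  · have h1 : P.eval x = 0 := by
      rw [hPe, prod_eq_zero (mem_range.2 (Nat.pos_of_ne_zero h0)) (by simp), zero_mul]
    rw [h1]
    simp

/-- The left hand side is the inner product of the monomial `z ^ (p - j) * z̄ ^ (q - j)` and the disk
polynomial with indices `p`, `q`, without its normalizing constant. -/
lemma sum_coeff_mul_moment {α : ℝ} (hα : -1 < α) {p q j : ℕ} (hj : j ≤ min p q) :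
    ∑ k ∈ range (min p q + 1), (-1) ^ k * Real.Gamma (α + p + q + 1 - k) /
        (k.factorial * (p - k).factorial * (q - k).factorial) * moment α (p + q - j - k) =
      if j = 0 then (α + 1) * Real.Gamma (α + p + 1) * Real.Gamma (α + q + 1) /
        Real.Gamma (α + p + q + 2) else 0 := by
  rcases le_total q p with h | h
  · rw [min_eq_right h] at hj ⊢
    exact sum_coeff_mul_moment_aux hα h hj
  · rw [min_eq_left h] at hj ⊢
    have e := sum_coeff_mul_moment_aux hα h hj
    simp only [add_comm q p, add_right_comm α (q : ℝ) p, mul_right_comm _ ((q - _).factorial : ℝ),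
      mul_right_comm _ (Real.Gamma (α + q + 1))] at e
    exact e

end Combinatorics

/-- The normalizing constant of the disk polynomial. -/
noncomputable def diskPolyNorm (α : ℝ) (p q : ℕ) : ℝ :=
  Real.sqrt ((α + p + q + 1) * p.factorial * q.factorial /
    ((α + 1) * Real.Gamma (α + p + 1) * Real.Gamma (α + q + 1)))

/-- The `k`-th coefficient of the disk polynomial, without the normalizing constant. -/
noncomputable def diskPolyCoeff (α : ℝ) (p q k : ℕ) : ℝ :=
  (-1) ^ k * Real.Gamma (α + p + q + 1 - k) /
    (k.factorial * (p - k).factorial * (q - k).factorial)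

lemma diskPolyLp_eq_sum {α : ℝ} (hα : -1 < α) (p q : ℕ) :
    diskPolyLp hα p q = (diskPolyNorm α p q : ℂ) • ∑ k ∈ Finset.range (min p q + 1),
      (diskPolyCoeff α p q k : ℂ) • monomialLp hα (p - k) (q - k) := by
  apply Lp.ext
  have h1 : ∀ᵐ z ∂(diskMeasure α), ∀ k, monomialLp hα (p - k) (q - k) z =
      monomial (p - k) (q - k) z :=
    ae_all_iff.2 fun k => (memLp_monomial hα (p - k) (q - k)).coeFn_toLp
  have h2 : ∀ᵐ z ∂(diskMeasure α), ∀ k : ℕ,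
      ((diskPolyCoeff α p q k : ℂ) • monomialLp hα (p - k) (q - k) : L2 α) z =
      (diskPolyCoeff α p q k : ℂ) • monomialLp hα (p - k) (q - k) z :=
    ae_all_iff.2 fun k => Lp.coeFn_smul _ _
  filter_upwards [(memLp_diskPoly hα p q).coeFn_toLp, h1, h2,
    Lp.coeFn_smul (diskPolyNorm α p q : ℂ) (∑ k ∈ Finset.range (min p q + 1),
      (diskPolyCoeff α p q k : ℂ) • monomialLp hα (p - k) (q - k)),
    Lp.coeFn_finsetSum (Finset.range (min p q + 1)) fun k =>
      (diskPolyCoeff α p q k : ℂ) • monomialLp hα (p - k) (q - k)] with z h0 h1 h2 h3 h4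
  rw [diskPolyLp, h0, h3, Pi.smul_apply, h4, Finset.sum_apply]
  simp only [h2, h1, smul_eq_mul]
  rfl

lemma inner_monomialLp_diskPolyLp {α : ℝ} (hα : -1 < α) {p q j : ℕ} (hj : j ≤ min p q) :
    inner ℂ (monomialLp hα (p - j) (q - j)) (diskPolyLp hα p q) =
      if j = 0 then (diskPolyNorm α p q * ((α + 1) * Real.Gamma (α + p + 1) *
        Real.Gamma (α + q + 1) / Real.Gamma (α + p + q + 2)) : ℝ) else 0 := by
  have h := sum_coeff_mul_moment hα hj
  rw [diskPolyLp_eq_sum, inner_smul_right, inner_sum]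
  have h' : ∀ k ∈ Finset.range (min p q + 1),
      inner ℂ (monomialLp hα (p - j) (q - j))
        ((diskPolyCoeff α p q k : ℂ) • monomialLp hα (p - k) (q - k)) =
      ((diskPolyCoeff α p q k * moment α (p + q - j - k) : ℝ) : ℂ) := by
    intro k hk
    have hk := Finset.mem_range.1 hk
    rw [inner_smul_right, inner_monomialLp, if_pos (by omega), Complex.ofReal_mul]
    congr 3
    omega
  rw [Finset.sum_congr rfl h', ← Complex.ofReal_sum]
  simp only [diskPolyCoeff, h]
  split_ifs <;> simp

lemma inner_diskPolyLp_of_add_ne {α : ℝ} (hα : -1 < α) {p q p' q' : ℕ} (h : p + q' ≠ q + p') :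
    inner ℂ (diskPolyLp hα p q) (diskPolyLp hα p' q') = 0 := by
  simp only [diskPolyLp_eq_sum, inner_smul_right, inner_smul_left, inner_sum, sum_inner]
  rw [Finset.sum_eq_zero, mul_zero]
  intro k hk
  rw [Finset.sum_eq_zero, mul_zero, mul_zero]
  intro l hl
  have hk := Finset.mem_range.1 hk
  have hl := Finset.mem_range.1 hl
  rw [inner_monomialLp, if_neg (by omega), mul_zero]

lemma diskPolyNorm_sq {α : ℝ} (hα : -1 < α) (p q : ℕ) :
    diskPolyNorm α p q * (diskPolyCoeff α p q 0 * (diskPolyNorm α p q *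
      ((α + 1) * Real.Gamma (α + p + 1) * Real.Gamma (α + q + 1) /
        Real.Gamma (α + p + q + 2)))) = 1 := by
  have hp : (0 : ℝ) ≤ p := Nat.cast_nonneg p
  have hq : (0 : ℝ) ≤ q := Nat.cast_nonneg q
  have g1 : 0 < Real.Gamma (α + p + 1) := Real.Gamma_pos_of_pos (by linarith)
  have g2 : 0 < Real.Gamma (α + q + 1) := Real.Gamma_pos_of_pos (by linarith)
  have h1 : 0 < α + p + q + 1 := by linarith
  have g3 : 0 < Real.Gamma (α + p + q + 1) := Real.Gamma_pos_of_pos h1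
  have h2 : 0 < α + 1 := by linarith
  have e : α + p + q + 2 = (α + p + q + 1) + 1 := by ring
  have hsq : diskPolyNorm α p q * diskPolyNorm α p q = (α + p + q + 1) * p.factorial * q.factorial /
      ((α + 1) * Real.Gamma (α + p + 1) * Real.Gamma (α + q + 1)) :=
    Real.mul_self_sqrt (by positivity)
  have f1 : ((p.factorial : ℝ)) ≠ 0 := Nat.cast_ne_zero.2 p.factorial_ne_zero
  have f2 : ((q.factorial : ℝ)) ≠ 0 := Nat.cast_ne_zero.2 q.factorial_ne_zero
  rw [mul_left_comm, ← mul_assoc (diskPolyNorm α p q) (diskPolyNorm α p q), hsq, e,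
    Real.Gamma_add_one h1.ne', diskPolyCoeff]
  simp only [pow_zero, one_mul, Nat.cast_zero, sub_zero, Nat.factorial_zero, Nat.cast_one,
    Nat.sub_zero]
  field_simp

/-- The disk polynomial with smaller indices is a combination of monomials that are orthogonal to the
larger one, except for the leading term if the indices coincide. -/
lemma inner_diskPolyLp_of_le {α : ℝ} (hα : -1 < α) {p q j : ℕ} (hj : j ≤ min p q) :
    inner ℂ (diskPolyLp hα (p - j) (q - j)) (diskPolyLp hα p q) = if j = 0 then 1 else 0 := by
  rw [diskPolyLp_eq_sum hα (p - j), inner_smul_left, sum_inner]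
  have h' : ∀ k ∈ Finset.range (min (p - j) (q - j) + 1),
      inner ℂ ((diskPolyCoeff α (p - j) (q - j) k : ℂ) • monomialLp hα (p - j - k) (q - j - k))
        (diskPolyLp hα p q) =
      if k = 0 then if j = 0 then ((diskPolyCoeff α p q 0 * (diskPolyNorm α p q *
        ((α + 1) * Real.Gamma (α + p + 1) *
        Real.Gamma (α + q + 1) / Real.Gamma (α + p + q + 2))) : ℝ) : ℂ) else 0 else 0 := by
    intro k hk
    have hk := Finset.mem_range.1 hk
    rw [inner_smul_left, Nat.sub_sub, Nat.sub_sub,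
      inner_monomialLp_diskPolyLp hα (j := j + k) (by omega), Complex.conj_ofReal]
    by_cases hk0 : k = 0
    · subst hk0
      by_cases hj0 : j = 0
      · subst hj0
        simp
      · simp [hj0]
    · simp [hk0]
  rw [Finset.sum_congr rfl h', Finset.sum_ite_eq' (Finset.range _) 0, if_pos (by simp)]
  split_ifs with hj0
  · subst hj0
    rw [Complex.conj_ofReal, ← Complex.ofReal_mul]
    simp only [Nat.sub_zero]
    rw [diskPolyNorm_sq hα]
    simp
  · simp

/-- The normalized disk polynomials are orthonormal. -/
lemma orthonormal_diskPolyLp {α : ℝ} (hα : -1 < α) :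
    Orthonormal ℂ fun x : ℕ × ℕ => diskPolyLp hα x.1 x.2 := by
  rw [orthonormal_iff_ite]
  rintro ⟨p, q⟩ ⟨p', q'⟩
  by_cases h : p + q' = q + p'
  · rcases le_total p p' with hp | hp
    · have h1 := inner_diskPolyLp_of_le hα (p := p') (q := q') (j := p' - p) (by omega)
      have e1 : p' - (p' - p) = p := by omega
      have e2 : q' - (p' - p) = q := by omega
      rw [e1, e2] at h1
      simp only [h1, Prod.mk.injEq]
      congr 1
      simp only [eq_iff_iff]
      omega
    · have h1 := inner_diskPolyLp_of_le hα (p := p) (q := q) (j := p - p') (by omega)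
      have e1 : p - (p - p') = p' := by omega
      have e2 : q - (p - p') = q' := by omega
      rw [e1, e2] at h1
      rw [← inner_conj_symm, h1]
      by_cases h0 : p - p' = 0
      · rw [if_pos h0, if_pos (Prod.ext (by simp; omega) (by simp; omega)), map_one]
      · rw [if_neg h0, if_neg (fun h2 => h0 (by simp at h2; omega)), map_zero]
  · rw [inner_diskPolyLp_of_add_ne hα h, if_neg]
    rintro h2
    simp only [Prod.mk.injEq] at h2
    omega

/-! ### The structure of polyanalytic functions -/

lemma dbar_conj_pow_mul {h : ℂ → ℂ} {z : ℂ} (hz : DifferentiableAt ℂ h z) (k : ℕ) :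
    dbar (fun w => conj w ^ k * h w) z = k * (conj z ^ (k - 1) * h z) := by
  have h1 : HasFDerivAt (𝕜 := ℝ) h _ z := hz.hasFDerivAt.restrictScalars ℝ
  have h2 : HasFDerivAt (𝕜 := ℝ) (fun z : ℂ => (conj z) ^ k) _ z :=
    (Complex.conjCLE.toContinuousLinearMap.hasFDerivAt (x := z)).pow k
  have h3 : fderiv ℝ (fun w => conj w ^ k * h w) z = _ := (h2.mul h1).fderiv
  simp only [dbar, h3]
  simp
  linear_combination (1 / 2 * conj z ^ k * deriv h z -
    1 / 2 * h z * k * conj z ^ (k - 1)) * Complex.I_sq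

lemma dbar_iterate_conj_pow_mul {h : ℂ → ℂ} (hh : DifferentiableOn ℂ h unitDisk) (k m : ℕ) :
    Set.EqOn (dbar^[m] fun w => conj w ^ k * h w)
      (fun w => (k.descFactorial m : ℂ) * (conj w ^ (k - m) * h w)) unitDisk := by
  induction m with
  | zero =>
    intro z _
    simp
  | succ m ih =>
    intro z hz
    have hz' : DifferentiableAt ℂ h z := hh.differentiableAt (Metric.isOpen_ball.mem_nhds hz)
    rw [Function.iterate_succ_apply', dbar_congr ih hz]
    have := congrFun (dbar_const_smul (k.descFactorial m : ℂ) fun w => conj w ^ (k - m) * h w) z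
    simp only [Pi.smul_def, smul_eq_mul] at this
    rw [this, dbar_conj_pow_mul hz', Nat.descFactorial_succ, Nat.sub_sub]
    push_cast
    ring

lemma contDiffOn_conj_pow_mul {h : ℂ → ℂ} (hh : DifferentiableOn ℂ h unitDisk) (k n : ℕ) :
    ContDiffOn ℝ n (fun w => conj w ^ k * h w) unitDisk :=
  (Complex.conjCLE.toContinuousLinearMap.contDiff.pow k).contDiffOn.mul
    ((hh.contDiffOn Metric.isOpen_ball).restrict_scalars ℝ)

lemma isPolyanalytic_conj_pow_mul {h : ℂ → ℂ} (hh : DifferentiableOn ℂ h unitDisk) {k n : ℕ}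
    (hk : k < n) : IsPolyanalytic n fun w => conj w ^ k * h w := by
  refine ⟨contDiffOn_conj_pow_mul hh k n, fun z hz => ?_⟩
  rw [dbar_iterate_conj_pow_mul hh k n hz]
  simp [Nat.descFactorial_eq_zero_iff_lt.2 hk]

lemma IsPolyanalytic.sum {n : ℕ} {ι : Type*} (s : Finset ι) {f : ι → ℂ → ℂ}
    (hf : ∀ i ∈ s, IsPolyanalytic n (f i)) : IsPolyanalytic n (∑ i ∈ s, f i) := by
  classical
  induction s using Finset.induction_on with
  | empty => simpa using isPolyanalytic_zero n
  | insert i s hi ih =>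
    rw [Finset.sum_insert hi]
    exact (hf i (Finset.mem_insert_self i s)).add
      (ih fun j hj => hf j (Finset.mem_insert_of_mem hj))

lemma contDiffOn_dbar_iterate {n m : ℕ} {f : ℂ → ℂ}
    (hf : ContDiffOn ℝ (n + m : ℕ) f unitDisk) : ContDiffOn ℝ m (dbar^[n] f) unitDisk := by
  induction n generalizing f with
  | zero => simpa using hf
  | succ n ih =>
    rw [Function.iterate_succ_apply]
    exact ih (contDiffOn_dbar (by rwa [Nat.add_right_comm] at hf))

/-- An `n`-analytic function is a polynomial in `z̄` of degree less than `n` with holomorphic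
coefficients. -/
lemma IsPolyanalytic.exists_eq_sum {n : ℕ} {f : ℂ → ℂ} (hf : IsPolyanalytic n f) :
    ∃ h : ℕ → ℂ → ℂ, (∀ k, DifferentiableOn ℂ (h k) unitDisk) ∧
      ∀ z ∈ unitDisk, f z = ∑ k ∈ Finset.range n, conj z ^ k * h k z := by
  induction n generalizing f with
  | zero => exact ⟨0, fun _ => differentiableOn_const 0, fun z hz => by simpa using hf.2 z hz⟩
  | succ n ih =>
    -- `g` is holomorphic, and it is `n!` times the coefficient of `z̄ ^ n`
    set g := dbar^[n] f with hg
    have hg1 : ContDiffOn ℝ (1 : ℕ) g unitDisk := contDiffOn_dbar_iterate hf.1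
    have hgd : DifferentiableOn ℂ g unitDisk := by
      intro z hz
      refine DifferentiableAt.differentiableWithinAt ?_
      rw [differentiableAt_complex_iff_differentiableAt_real]
      refine ⟨(hg1.differentiableOn (by norm_num)).differentiableAt
        (Metric.isOpen_ball.mem_nhds hz), ?_⟩
      have h0 := hf.2 z hz
      rw [Function.iterate_succ_apply', ← hg, dbar] at h0
      have h1 : fderiv ℝ g z 1 + Complex.I * fderiv ℝ g z Complex.I = 0 := by simpa using h0
      -- the equation `∂g/∂z̄ = 0` is the Cauchy-Riemann equation
      rw [smul_eq_mul]
      linear_combination (-Complex.I) * h1 + fderiv ℝ g z Complex.I * Complex.I_sq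
    have hsub : IsPolyanalytic n (f + (-(n.factorial : ℂ)⁻¹) • fun w => conj w ^ n * g w) := by
      have hf' : ContDiffOn ℝ n f unitDisk := hf.1.of_le (by exact_mod_cast Nat.le_succ n)
      have hg' : ContDiffOn ℝ n ((-(n.factorial : ℂ)⁻¹) • fun w => conj w ^ n * g w) unitDisk :=
        (contDiffOn_conj_pow_mul hgd n n).const_smul (-(n.factorial : ℂ)⁻¹)
      refine ⟨hf'.add hg', fun z hz => ?_⟩
      rw [dbar_iterate_add n hf' hg' hz, dbar_iterate_const_smul, Pi.add_apply,
        Pi.smul_apply, dbar_iterate_conj_pow_mul hgd n n hz, ← hg]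
      have : (n.factorial : ℂ) ≠ 0 := Nat.cast_ne_zero.2 n.factorial_ne_zero
      simp [Nat.descFactorial_self, this]
    obtain ⟨h, hh, e⟩ := ih hsub
    refine ⟨fun k => if k = n then (n.factorial : ℂ)⁻¹ • g else h k, fun k => ?_, fun z hz => ?_⟩
    · dsimp only
      split_ifs
      · exact hgd.const_smul _
      · exact hh k
    · have e1 := e z hz
      have e2 : ∀ k ∈ Finset.range n, conj z ^ k *
          (if k = n then (n.factorial : ℂ)⁻¹ • g else h k) z = conj z ^ k * h k z := fun k hk => by
        rw [if_neg (Finset.mem_range.1 hk).ne]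
      rw [Finset.sum_range_succ]
      dsimp only
      rw [if_pos rfl, Finset.sum_congr rfl e2, ← e1]
      simp only [Pi.add_apply, Pi.smul_apply, smul_eq_mul]
      ring

/-! ### Orthogonal sums of the frequency blocks are polyanalytic -/

/-- The functions of a block in terms of monomials, indexed by the exponent `k < n` of `z̄`. The
exponents `k` with `k + ξ < 0` do not occur: their coefficients are required to vanish, and the
value `0` of `(k + ξ).toNat` plays no role. -/
lemma exists_eq_sum_of_mem_freqBlock {n : ℕ} {α : ℝ} (hα : -1 < α) {ξ : Freq n} {f : L2 α}
    (hf : f ∈ freqBlock n hα ξ) :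
    ∃ c : Fin n → ℂ, (∀ k : Fin n, (k : ℤ) + ξ.1 < 0 → c k = 0) ∧
      f = ∑ k : Fin n, c k • monomialLp hα ((k : ℤ) + ξ.1).toNat k := by
  induction hf using Submodule.span_induction with
  | mem f hf =>
    obtain ⟨p, q, h1, h2, rfl⟩ := hf
    have h3 := ξ.2
    unfold blockSize at h2
    have hq : q < n := by omega
    refine ⟨Pi.single ⟨q, hq⟩ 1, fun k hk => ?_, ?_⟩
    · refine Pi.single_eq_of_ne ?_ _
      rintro rfl
      simp only at hk
      omega
    · rw [Finset.sum_eq_single ⟨q, hq⟩ (fun k _ hk => by rw [Pi.single_eq_of_ne hk, zero_smul])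
        (fun h => absurd (Finset.mem_univ _) h), Pi.single_eq_same, one_smul]
      have : ((q : ℤ) + ξ.1).toNat = p := by omega
      simp only [this]
      rfl
  | zero => exact ⟨0, fun _ _ => rfl, by simp⟩
  | add f g _ _ hf hg =>
    obtain ⟨c, h1, rfl⟩ := hf
    obtain ⟨d, h2, rfl⟩ := hg
    refine ⟨c + d, fun k hk => by simp [h1 k hk, h2 k hk], ?_⟩
    simp [add_smul, Finset.sum_add_distrib]
  | smul r f _ hf =>
    obtain ⟨c, h1, rfl⟩ := hf
    refine ⟨r • c, fun k hk => by simp [h1 k hk], ?_⟩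
    simp [mul_smul, Finset.smul_sum]

lemma coeFn_sum_monomialLp {α : ℝ} (hα : -1 < α) {ι : Type*} [Fintype ι] (c : ι → ℂ)
    (p q : ι → ℕ) :
    ⇑(∑ k, c k • monomialLp hα (p k) (q k)) =ᵐ[diskMeasure α]
      fun z => ∑ k, c k * monomial (p k) (q k) z := by
  have h1 : ∀ᵐ z ∂(diskMeasure α), ∀ k, monomialLp hα (p k) (q k) z = monomial (p k) (q k) z :=
    Filter.eventually_all.2 fun k => (memLp_monomial hα (p k) (q k)).coeFn_toLp
  have h2 : ∀ᵐ z ∂(diskMeasure α), ∀ k,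
      (c k • monomialLp hα (p k) (q k) : L2 α) z = c k • monomialLp hα (p k) (q k) z :=
    Filter.eventually_all.2 fun k => Lp.coeFn_smul _ _
  filter_upwards [h1, h2, Lp.coeFn_finsetSum Finset.univ fun k => c k • monomialLp hα (p k) (q k)]
    with z h1 h2 h3
  rw [h3, Finset.sum_apply]
  simp only [h2, h1, smul_eq_mul]

/-- A function of the block with frequency `ξ` is `z ^ ξ` times a polynomial in `|z| ^ 2`. The
factors `z ^ n` avoid negative exponents. -/
lemma pow_mul_sum_monomial {n : ℕ} (ξ : Freq n) (c : Fin n → ℂ)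
    (hc : ∀ k : Fin n, (k : ℤ) + ξ.1 < 0 → c k = 0) (z : ℂ) :
    z ^ n * ∑ k : Fin n, c k * monomial ((k : ℤ) + ξ.1).toNat k z =
      z ^ (ξ.1 + n).toNat * ∑ k : Fin n, c k * monomial k k z := by
  rw [Finset.mul_sum, Finset.mul_sum]
  refine Finset.sum_congr rfl fun k _ => ?_
  by_cases hk : (k : ℤ) + ξ.1 < 0
  · simp [hc k hk]
  · have h := ξ.2
    have e : n + ((k : ℤ) + ξ.1).toNat = (ξ.1 + n).toNat + k := by omega
    simp only [monomial]
    calc z ^ n * (c k * (z ^ ((k : ℤ) + ξ.1).toNat * conj z ^ (k : ℕ))) =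
        c k * (z ^ (n + ((k : ℤ) + ξ.1).toNat) * conj z ^ (k : ℕ)) := by
          rw [pow_add]
          ring
      _ = _ := by
          rw [e, pow_add]
          ring

/-- A polynomial in `|z| ^ 2` that vanishes almost everywhere on an annulus is zero. -/
lemma eq_zero_of_sum_monomial_eq_zero {n : ℕ} {α R : ℝ} (hα : -1 < α) (hR0 : 0 < R) (hR : R < 1)
    {c : Fin n → ℂ} (hc : ∀ᵐ z ∂((diskMeasure α).restrict {z : ℂ | R < ‖z‖}),
      ∑ k : Fin n, c k * monomial k k z = 0) : c = 0 := by
  have hmS : MeasurableSet {z : ℂ | R < ‖z‖} := measurableSet_lt measurable_const measurable_norm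
  have hm : Measurable fun z : ℂ =>
      ENNReal.ofReal ((α + 1) / Real.pi * (1 - ‖z‖ ^ 2) ^ α) := by fun_prop
  let A : Set ℂ := {z | R < ‖z‖} ∩ unitDisk
  have hA : IsOpen A := (isOpen_lt continuous_const continuous_norm).inter Metric.isOpen_ball
  have h1 : (fun z => ∑ k : Fin n, c k * monomial k k z) =ᵐ[volume.restrict A] fun _ => 0 := by
    rw [ae_restrict_iff' hmS, diskMeasure, ae_withDensity_iff hm,
      ae_restrict_iff' measurableSet_ball] at hc
    rw [Filter.EventuallyEq, ae_restrict_iff' hA.measurableSet]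
    filter_upwards [hc] with z hz hzA
    refine hz hzA.2 ?_ hzA.1
    have hz1 : ‖z‖ < 1 := by simpa using hzA.2
    have hz2 : 0 < 1 - ‖z‖ ^ 2 := by nlinarith [norm_nonneg z]
    have : 0 < α + 1 := by linarith
    rw [Ne, ENNReal.ofReal_eq_zero, not_le]
    positivity
  have hcont : Continuous fun z => ∑ k : Fin n, c k * monomial k k z :=
    continuous_finsetSum _ fun k _ => continuous_const.mul (continuous_monomial _ _)
  have h2 := Measure.eqOn_open_of_ae_eq h1 hA hcont.continuousOn continuousOn_const
  let P : Polynomial ℂ := ∑ k : Fin n, Polynomial.monomial (k : ℕ) (c k)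
  have hP : P = 0 := by
    refine Polynomial.eq_zero_of_infinite_isRoot P ?_
    refine Set.Infinite.mono (s := (fun r : ℝ => ((r ^ 2 : ℝ) : ℂ)) '' Set.Ioo R 1) ?_ ?_
    · rintro _ ⟨r, hr, rfl⟩
      have hr0 : 0 < r := hR0.trans hr.1
      have hr1 : (r : ℂ) ∈ A := by
        refine ⟨?_, ?_⟩
        · simpa [abs_of_pos hr0] using hr.1
        · simpa [abs_of_pos hr0] using hr.2
      have h3 := h2 hr1
      have h4 : ∀ k : ℕ, monomial k k (r : ℂ) = ((r ^ 2 : ℝ) : ℂ) ^ k := fun k => by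
        simp only [monomial, Complex.conj_ofReal]
        push_cast
        rw [← mul_pow, sq]
      simp only [h4] at h3
      change P.IsRoot _
      rw [Polynomial.IsRoot.def]
      simp only [P, Polynomial.eval_finsetSum, Polynomial.eval_monomial]
      exact h3
    · refine (Set.Ioo_infinite hR).image ?_
      intro r hr s hs h
      have h' : r ^ 2 = s ^ 2 := Complex.ofReal_injective h
      exact (pow_left_inj₀ (hR0.trans hr.1).le (hR0.trans hs.1).le two_ne_zero).1 h'
  funext k
  have h3 := congrArg (fun Q : Polynomial ℂ => Q.coeff k) hP
  simp only [P, Polynomial.finsetSum_coeff, Polynomial.coeff_monomial, Polynomial.coeff_zero,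
    Fin.val_inj, Finset.sum_ite_eq', Finset.mem_univ, if_true] at h3
  exact h3

/-- The coefficients of the functions of a block are controlled by the `L²` norm, with a constant
that grows with the frequency at most like `R ^ (-ξ)`, for every `R < 1`. On the annulus
`R < |z| < 1`, the factor `z ^ ξ` is harmless, and the polynomials in `|z| ^ 2` that remain
form a finite dimensional space which does not depend on `ξ`. -/
lemma exists_norm_coeff_mul_pow_le (n : ℕ) {α R : ℝ} (hα : -1 < α) (hR0 : 0 < R) (hR : R < 1) :
    ∃ K : ℝ, 0 ≤ K ∧ ∀ (ξ : Freq n) (c : Fin n → ℂ), (∀ k : Fin n, (k : ℤ) + ξ.1 < 0 → c k = 0) →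
      ∀ k, ‖c k‖ * R ^ (ξ.1 + n).toNat ≤
        K * ‖∑ k : Fin n, c k • monomialLp hα ((k : ℤ) + ξ.1).toNat k‖ := by
  have hmS : MeasurableSet {z : ℂ | R < ‖z‖} := measurableSet_lt measurable_const measurable_norm
  let ν := (diskMeasure α).restrict {z : ℂ | R < ‖z‖}
  let v : Fin n → Lp ℂ 2 ν := fun k => ((memLp_monomial hα k k).restrict _).toLp (monomial k k)
  have hv : ∀ c : Fin n → ℂ, ⇑(∑ k, c k • v k) =ᵐ[ν] fun z => ∑ k : Fin n, c k * monomial k k z := by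
    intro c
    have h1 : ∀ᵐ z ∂ν, ∀ k, v k z = monomial k k z :=
      Filter.eventually_all.2 fun k => ((memLp_monomial hα k k).restrict _).coeFn_toLp
    have h2 : ∀ᵐ z ∂ν, ∀ k, (c k • v k : Lp ℂ 2 ν) z = c k • v k z :=
      Filter.eventually_all.2 fun k => Lp.coeFn_smul _ _
    filter_upwards [h1, h2, Lp.coeFn_finsetSum Finset.univ fun k => c k • v k] with z h1 h2 h3
    rw [h3, Finset.sum_apply]
    simp only [h2, h1, smul_eq_mul]
  let L : (Fin n → ℂ) →ₗ[ℂ] Lp ℂ 2 ν := Fintype.linearCombination ℂ v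
  have hL : ∀ c, L c = ∑ k, c k • v k := fun c => Fintype.linearCombination_apply ℂ v c
  have hker : LinearMap.ker L = ⊥ := by
    rw [LinearMap.ker_eq_bot']
    intro c hc
    refine eq_zero_of_sum_monomial_eq_zero hα hR0 hR ?_
    rw [hL] at hc
    have h1 := hv c
    rw [hc] at h1
    filter_upwards [h1, Lp.coeFn_zero ℂ 2 ν] with z h1 h2
    rw [← h1, h2]
    rfl
  obtain ⟨K, -, hK⟩ := L.exists_antilipschitzWith hker
  refine ⟨K, K.2, fun ξ c hc k => ?_⟩
  set g := ∑ k : Fin n, c k • monomialLp hα ((k : ℤ) + ξ.1).toNat k with hg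
  let g' : Lp ℂ 2 ν := ((Lp.memLp g).restrict _).toLp g
  have h1 : ‖g'‖ ≤ ‖g‖ := by
    rw [Lp.norm_toLp, Lp.norm_def]
    exact ENNReal.toReal_mono (Lp.eLpNorm_ne_top g) (eLpNorm_mono_measure _ Measure.restrict_le_self)
  have hRN : 0 < R ^ (ξ.1 + n).toNat := pow_pos hR0 _
  have h2 : ‖L c‖ ≤ (R ^ (ξ.1 + n).toNat)⁻¹ * ‖g'‖ := by
    rw [hL]
    refine Lp.norm_le_mul_norm_of_ae_le_mul ?_
    filter_upwards [hv c, ((Lp.memLp g).restrict _).coeFn_toLp,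
      ae_restrict_of_ae (coeFn_sum_monomialLp hα c (fun k => ((k : ℤ) + ξ.1).toNat) fun k => k),
      ae_restrict_of_ae (ae_mem_unitDisk α), ae_restrict_mem hmS] with z e1 e2 e3 hz1 hz2
    have hz1 : ‖z‖ ≤ 1 := by simpa using (Metric.mem_ball.1 hz1).le
    rw [e1, e2, hg, e3, inv_mul_eq_div, le_div_iff₀ hRN]
    have e := congrArg norm (pow_mul_sum_monomial ξ c hc z)
    rw [norm_mul, norm_mul, norm_pow, norm_pow] at e
    calc ‖∑ k : Fin n, c k * monomial k k z‖ * R ^ (ξ.1 + n).toNat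
        ≤ ‖∑ k : Fin n, c k * monomial k k z‖ * ‖z‖ ^ (ξ.1 + n).toNat := by
          have : R ≤ ‖z‖ := le_of_lt hz2
          gcongr
      _ = ‖z‖ ^ n * ‖∑ k : Fin n, c k * monomial ((k : ℤ) + ξ.1).toNat k z‖ := by
          rw [e, mul_comm]
      _ ≤ 1 * ‖∑ k : Fin n, c k * monomial ((k : ℤ) + ξ.1).toNat k z‖ := by
          gcongr
          exact pow_le_one₀ (norm_nonneg _) hz1
      _ = _ := one_mul _
  have h3 : ‖c‖ ≤ K * ‖L c‖ := by
    have := hK.le_mul_dist c 0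
    simpa using this
  calc ‖c k‖ * R ^ (ξ.1 + n).toNat ≤ (K * ((R ^ (ξ.1 + n).toNat)⁻¹ * ‖g‖)) * R ^ (ξ.1 + n).toNat := by
        refine mul_le_mul_of_nonneg_right ?_ hRN.le
        refine (norm_le_pi_norm c k).trans (h3.trans ?_)
        refine mul_le_mul_of_nonneg_left (h2.trans ?_) K.2
        exact mul_le_mul_of_nonneg_left h1 (inv_nonneg.2 hRN.le)
    _ = K * ‖g‖ := by
        field_simp

lemma linearIndependent_block {n : ℕ} {α : ℝ} (hα : -1 < α) (ξ : Freq n) {c : Fin n → ℂ}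
    (hc : ∀ k : Fin n, (k : ℤ) + ξ.1 < 0 → c k = 0)
    (h : ∑ k : Fin n, c k • monomialLp hα ((k : ℤ) + ξ.1).toNat k = 0) : c = 0 := by
  obtain ⟨K, -, hK⟩ := exists_norm_coeff_mul_pow_le n hα (R := 1 / 2) (by norm_num) (by norm_num)
  funext k
  have h1 := hK ξ c hc k
  rw [h, norm_zero, mul_zero] at h1
  have h2 : (0 : ℝ) < (1 / 2) ^ (ξ.1 + n).toNat := by positivity
  exact norm_le_zero_iff.1 (nonpos_of_mul_nonpos_left h1 h2)

/-- The enumeration of the frequencies `ξ ≥ -n + 1` by the natural numbers. -/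
def freqEquiv (n : ℕ) : ℕ ≃ Freq n where
  toFun N := ⟨N - n + 1, by omega⟩
  invFun ξ := (ξ.1 + n - 1).toNat
  left_inv N := by
    simp only
    omega
  right_inv ξ := by
    have := ξ.2
    apply Subtype.ext
    simp only
    omega

/-- An `L²` convergent series of functions of the frequency blocks has an `n`-analytic sum. -/
lemma mem_bergman_of_hasSum {n : ℕ} {α : ℝ} (hα : -1 < α) {g : Freq n → L2 α} {f : L2 α}
    (hg : ∀ ξ, g ξ ∈ freqBlock n hα ξ) {C : ℝ} (hC : ∀ ξ, ‖g ξ‖ ≤ C) (hf : HasSum g f) :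
    f ∈ bergman n α := by
  choose c hc0 hc using fun ξ => exists_eq_sum_of_mem_freqBlock hα (hg ξ)
  have hC0 : 0 ≤ C := (norm_nonneg _).trans (hC (freqEquiv n 0))
  let t : Fin n → ℕ → ℂ → ℂ := fun k N z =>
    c (freqEquiv n N) k * z ^ ((k : ℤ) + (freqEquiv n N).1).toNat
  have hbound : ∀ (k : Fin n) (ρ : ℝ), 0 < ρ → ρ < 1 → ∃ u : ℕ → ℝ, Summable u ∧
      ∀ N z, z ∈ Metric.ball (0 : ℂ) ρ → ‖t k N z‖ ≤ u N := by
    intro k ρ hρ0 hρ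
    obtain ⟨R, hρR, hR⟩ := exists_between hρ
    have hR0 := hρ0.trans hρR
    obtain ⟨K, hK0, hK⟩ := exists_norm_coeff_mul_pow_le n hα hR0 hR
    refine ⟨fun N => K * C / ρ ^ n * (ρ / R) ^ (N + 1), ?_, fun N z hz => ?_⟩
    · refine Summable.mul_left _ ?_
      refine (summable_nat_add_iff (f := fun N => (ρ / R) ^ N) 1).2 ?_
      exact summable_geometric_of_lt_one (by positivity) ((div_lt_one hR0).2 hρR)
    · have hz' : ‖z‖ ≤ ρ := by simpa using (Metric.mem_ball.1 hz).le
      have h1 := hK (freqEquiv n N) _ (hc0 _) k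
      rw [← hc] at h1
      have h2 : ((freqEquiv n N).1 + n).toNat = N + 1 := by
        simp only [freqEquiv, Equiv.coe_fn_mk]
        omega
      rw [h2] at h1
      have h3 := h1.trans (mul_le_mul_of_nonneg_left (hC _) hK0)
      by_cases hk : (k : ℤ) + (freqEquiv n N).1 < 0
      · simp only [t, hc0 _ k hk, zero_mul, norm_zero]
        positivity
      · have h4 : ((k : ℤ) + (freqEquiv n N).1).toNat + n = k + (N + 1) := by
          simp only [freqEquiv, Equiv.coe_fn_mk] at hk ⊢
          omega
        have h5 : ρ ^ ((k : ℤ) + (freqEquiv n N).1).toNat * ρ ^ n ≤ ρ ^ (N + 1) := by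
          rw [← pow_add, h4, pow_add]
          exact mul_le_of_le_one_left (by positivity) (pow_le_one₀ hρ0.le hρ.le)
        have h6 : ‖c (freqEquiv n N) k‖ ≤ K * C / R ^ (N + 1) := by
          rwa [le_div_iff₀ (by positivity)]
        have h7 : ρ ^ ((k : ℤ) + (freqEquiv n N).1).toNat ≤ ρ ^ (N + 1) / ρ ^ n := by
          rwa [le_div_iff₀ (by positivity)]
        calc ‖t k N z‖ = ‖c (freqEquiv n N) k‖ * ‖z‖ ^ ((k : ℤ) + (freqEquiv n N).1).toNat := by
              simp only [t, norm_mul, norm_pow]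
          _ ≤ (K * C / R ^ (N + 1)) * (ρ ^ (N + 1) / ρ ^ n) := by
              refine mul_le_mul h6 ((pow_le_pow_left₀ (norm_nonneg _) hz' _).trans h7)
                (by positivity) (by positivity)
          _ = _ := by
              simp only [div_pow]
              ring
  let h : Fin n → ℂ → ℂ := fun k z => ∑' N, t k N z
  have hρ : ∀ z ∈ unitDisk, ∃ ρ, 0 < ρ ∧ ρ < 1 ∧ z ∈ Metric.ball (0 : ℂ) ρ := fun z hz => by
    have hz' : ‖z‖ < 1 := by simpa using hz
    obtain ⟨ρ, h1, h2⟩ := exists_between hz'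
    exact ⟨ρ, (norm_nonneg _).trans_lt h1, h2, by simpa using h1⟩
  have hh : ∀ k, DifferentiableOn ℂ (h k) unitDisk := fun k z hz => by
    obtain ⟨ρ, h0, h1, hzρ⟩ := hρ z hz
    obtain ⟨u, hu, hu'⟩ := hbound k ρ h0 h1
    have := Complex.differentiableOn_tsum_of_summable_norm hu
      (fun N => ((differentiable_const _).mul (differentiable_id.pow _)).differentiableOn)
      Metric.isOpen_ball hu'
    exact (this.differentiableAt (Metric.isOpen_ball.mem_nhds hzρ)).differentiableWithinAt
  have hsum : ∀ k, ∀ z ∈ unitDisk, HasSum (fun N => t k N z) (h k z) := fun k z hz => by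
    obtain ⟨ρ, h0, h1, hzρ⟩ := hρ z hz
    obtain ⟨u, hu, hu'⟩ := hbound k ρ h0 h1
    exact (Summable.of_norm_bounded hu fun N => hu' N z hzρ).hasSum
  refine ⟨∑ k : Fin n, fun z => conj z ^ (k : ℕ) * h k z,
    IsPolyanalytic.sum _ fun k _ => isPolyanalytic_conj_pow_mul (hh k) k.2, ?_⟩
  -- the partial sums converge in `L²`, hence almost everywhere along a subsequence
  have hlim := ((freqEquiv n).hasSum_iff.2 hf).tendsto_sum_nat
  obtain ⟨φ, hφ, hae⟩ := (tendstoInMeasure_of_tendsto_Lp hlim).exists_seq_tendsto_ae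
  have h1 : ∀ᵐ z ∂(diskMeasure α), ∀ N, g (freqEquiv n N) z =
      ∑ k : Fin n, c (freqEquiv n N) k * monomial ((k : ℤ) + (freqEquiv n N).1).toNat k z :=
    ae_all_iff.2 fun N => by
      have := coeFn_sum_monomialLp hα (c (freqEquiv n N))
        (fun k => ((k : ℤ) + (freqEquiv n N).1).toNat) fun k => k
      rwa [← hc] at this
  have h2 : ∀ᵐ z ∂(diskMeasure α), ∀ M, (∑ N ∈ Finset.range M, (g ∘ freqEquiv n) N : L2 α) z =
      ∑ N ∈ Finset.range M, g (freqEquiv n N) z := ae_all_iff.2 fun M => by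
    filter_upwards [Lp.coeFn_finsetSum (Finset.range M) (g ∘ freqEquiv n)] with z hz
    rw [hz, Finset.sum_apply]
    rfl
  filter_upwards [hae, h1, h2, ae_mem_unitDisk α] with z hz h1 h2 hzd
  refine tendsto_nhds_unique hz ?_
  have h3 : Filter.Tendsto (fun M => ∑ k : Fin n, conj z ^ (k : ℕ) * ∑ N ∈ Finset.range M, t k N z)
      Filter.atTop (nhds (∑ k : Fin n, conj z ^ (k : ℕ) * h k z)) :=
    tendsto_finsetSum _ fun k _ => (hsum k z hzd).tendsto_sum_nat.const_mul _
  rw [Finset.sum_apply]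
  refine (h3.comp hφ.tendsto_atTop).congr fun j => ?_
  simp only [Function.comp_def] at h2 ⊢
  rw [h2]
  simp only [h1]
  rw [Finset.sum_comm]
  refine Finset.sum_congr rfl fun k _ => ?_
  rw [Finset.mul_sum]
  refine Finset.sum_congr rfl fun N _ => ?_
  simp only [t, monomial]
  ring

lemma orthogonalFamily_freqBlock (n : ℕ) {α : ℝ} (hα : -1 < α) :
    OrthogonalFamily ℂ (fun ξ : Freq n => freqBlock n hα ξ)
      fun ξ => (freqBlock n hα ξ).subtypeₗᵢ := by
  rintro ξ η hne ⟨f, hf⟩ ⟨g, hg⟩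
  obtain ⟨c, hc, rfl⟩ := exists_eq_sum_of_mem_freqBlock hα hf
  obtain ⟨d, hd, rfl⟩ := exists_eq_sum_of_mem_freqBlock hα hg
  have hne' : ξ.1 ≠ η.1 := fun h => hne (Subtype.ext h)
  simp only [Submodule.coe_subtypeₗᵢ, Submodule.subtype_apply, inner_sum, sum_inner,
    inner_smul_left, inner_smul_right]
  refine Finset.sum_eq_zero fun k _ => ?_
  by_cases hk : (k : ℤ) + η.1 < 0
  · rw [hd k hk, zero_mul]
  refine mul_eq_zero_of_right _ (Finset.sum_eq_zero fun l _ => ?_)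
  by_cases hl : (l : ℤ) + ξ.1 < 0
  · simp [hc l hl]
  rw [inner_monomialLp, if_neg (by omega), mul_zero]

lemma closure_iSup_freqBlock_le_bergman (n : ℕ) {α : ℝ} (hα : -1 < α) :
    (⨆ ξ : Freq n, freqBlock n hα ξ).topologicalClosure ≤ bergman n α := by
  intro f hf
  have hV := orthogonalFamily_freqBlock n hα
  have h1 := hV.range_linearIsometry
  simp only [Submodule.subtypeₗᵢ_toLinearMap, Submodule.range_subtype] at h1
  rw [← h1] at hf
  obtain ⟨g, rfl⟩ := hf
  exact mem_bergman_of_hasSum hα (fun ξ => (g ξ).2)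
    (fun ξ => lp.norm_apply_le_norm (by simp) g ξ) (hV.hasSum_linearIsometry g)

/-! ### The frequency blocks span a dense subspace of the Bergman space -/

lemma integrable_monomial {α : ℝ} (hα : -1 < α) (a b : ℕ) :
    Integrable (monomial a b) (diskMeasure α) :=
  haveI := isFiniteMeasure_diskMeasure hα
  (memLp_monomial hα a b).integrable one_le_two

/-- On a smaller disk, only one term of the power series of `h` has a nonzero integral against
a given monomial. -/
lemma setIntegral_monomial_mul {α R : ℝ} (hα : -1 < α) (hR0 : 0 < R) (hR : R < 1) {h : ℂ → ℂ}
    {a : ℕ → ℂ} (ha : ∀ z ∈ unitDisk, HasSum (fun j => a j * z ^ j) (h z)) (A B : ℕ) :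
    ∫ z in Metric.ball 0 R, monomial A B z * h z ∂(diskMeasure α) =
      if A ≤ B then a (B - A) * ∫ z in Metric.ball 0 R, monomial B B z ∂(diskMeasure α) else 0 := by
  have := isFiniteMeasure_diskMeasure hα
  let ν := (diskMeasure α).restrict (Metric.ball 0 R)
  have hball : ∀ᵐ z ∂ν, ‖z‖ < R := by
    filter_upwards [ae_restrict_mem measurableSet_ball] with z hz
    simpa using hz
  have hsum : Summable fun j => ‖a j‖ * R ^ j := by
    have h1 := (ha (R : ℂ) (by simpa [abs_of_pos hR0] using hR)).summable.norm
    simpa [abs_of_pos hR0] using h1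
  let F : ℕ → ℂ → ℂ := fun j z => a j * monomial (A + j) B z
  have hF : ∀ j, Integrable (F j) ν := fun j =>
    ((integrable_monomial hα _ _).restrict).const_mul _
  have hF' : Summable fun j => ∫ z, ‖F j z‖ ∂ν := by
    refine Summable.of_nonneg_of_le (fun j => integral_nonneg fun z => norm_nonneg _) (fun j => ?_)
      (hsum.mul_right (ν.real Set.univ))
    calc ∫ z, ‖F j z‖ ∂ν ≤ ∫ _, ‖a j‖ * R ^ j ∂ν := by
          refine integral_mono_ae (hF j).norm (integrable_const _) ?_
          filter_upwards [hball] with z hz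
          simp only [F, norm_mul, norm_monomial]
          refine mul_le_mul_of_nonneg_left ?_ (norm_nonneg _)
          rw [add_right_comm, pow_add]
          refine (mul_le_of_le_one_left (by positivity)
            (pow_le_one₀ (norm_nonneg _) (hz.trans hR).le)).trans ?_
          exact pow_le_pow_left₀ (norm_nonneg _) hz.le _
      _ = ‖a j‖ * R ^ j * ν.real Set.univ := by
          rw [integral_const, smul_eq_mul, mul_comm]
  have h1 := hasSum_integral_of_summable_integral_norm hF hF'
  have h2 : ∫ z, (∑' j, F j z) ∂ν = ∫ z, monomial A B z * h z ∂ν := by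
    refine integral_congr_ae ?_
    filter_upwards [hball] with z hz
    have h3 := (ha z (by simpa using hz.trans hR)).mul_left (monomial A B z)
    rw [← h3.tsum_eq]
    refine tsum_congr fun j => ?_
    simp only [F, monomial, pow_add]
    ring
  rw [h2] at h1
  have h3 : ∀ j, A + j ≠ B → ∫ z, F j z ∂ν = 0 := fun j hj => by
    simp only [F]
    rw [integral_const_mul, integral_monomial_eq_zero (measurePreserving_circle_mul_ball α R) hj,
      mul_zero]
  refine h1.unique ?_
  split_ifs with hAB
  · convert! hasSum_single (B - A) fun j hj => h3 j (by omega) using 1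
    simp only [F]
    rw [integral_const_mul, Nat.add_sub_cancel' hAB]
  · convert! hasSum_zero using 2 with j
    exact h3 j (by omega)

lemma tendsto_setIntegral_ball {α : ℝ} {f : ℂ → ℂ} (hf : Integrable f (diskMeasure α)) :
    Filter.Tendsto (fun m : ℕ => ∫ z in Metric.ball 0 (1 - 1 / ((m : ℝ) + 2)), f z ∂(diskMeasure α))
      Filter.atTop (nhds (∫ z, f z ∂(diskMeasure α))) := by
  have h1 : (⋃ m : ℕ, Metric.ball (0 : ℂ) (1 - 1 / ((m : ℝ) + 2))) = unitDisk := by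
    ext z
    simp only [Set.mem_iUnion, mem_ball_zero_iff]
    constructor
    · rintro ⟨m, hm⟩
      have : (0 : ℝ) < 1 / ((m : ℝ) + 2) := by positivity
      linarith
    · intro hz
      obtain ⟨m, hm⟩ := exists_nat_one_div_lt (sub_pos.2 hz)
      refine ⟨m, ?_⟩
      have : 1 / ((m : ℝ) + 2) ≤ 1 / ((m : ℝ) + 1) := by
        apply one_div_le_one_div_of_le <;> linarith [(Nat.cast_nonneg m : (0 : ℝ) ≤ m)]
      linarith
  have h2 : (diskMeasure α).restrict unitDisk = diskMeasure α :=
    Measure.restrict_eq_self_of_ae_mem (ae_mem_unitDisk α)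
  have h3 := tendsto_setIntegral_of_monotone (μ := diskMeasure α) (f := f)
    (s := fun m : ℕ => Metric.ball (0 : ℂ) (1 - 1 / ((m : ℝ) + 2)))
    (fun _ => measurableSet_ball) (fun m m' hm => Metric.ball_subset_ball (by
      have : (m : ℝ) ≤ m' := Nat.cast_le.2 hm
      gcongr)) hf.integrableOn
  rwa [h1, h2] at h3

/-- An `n`-analytic function that is orthogonal to all blocks vanishes: the integrals of its
products with monomials over the disks of radius less than one are given by the Taylor coefficients
of the holomorphic coefficients of the powers of `z̄`, and so the part of its expansion with any
fixed frequency is orthogonal to the block to which it belongs. -/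
lemma eq_zero_of_mem_bergman_of_inner_eq_zero {n : ℕ} {α : ℝ} (hα : -1 < α) {f : L2 α}
    (hf : f ∈ bergman n α) (h0 : ∀ p q, q < n → inner ℂ (monomialLp hα p q) f = 0) : f = 0 := by
  have := isFiniteMeasure_diskMeasure hα
  obtain ⟨g, hg, hfg⟩ := hf
  obtain ⟨h, hh, hgh⟩ := hg.exists_eq_sum
  let a : ℕ → ℕ → ℂ := fun k j => (j.factorial : ℂ)⁻¹ * iteratedDeriv j (h k) 0
  have ha : ∀ k, ∀ z ∈ unitDisk, HasSum (fun j => a k j * z ^ j) (h k z) := fun k z hz => by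
    have h1 := Complex.hasSum_taylorSeries_on_ball (hh k) hz
    convert! h1 using 2 with j
    simp only [a, sub_zero, smul_eq_mul]
    ring
  -- the orthogonality relations, as relations between the Taylor coefficients
  have key : ∀ p q, q < n → ∑ k ∈ Finset.range n,
      (if q ≤ p + k then a k (p + k - q) else 0) * (moment α (p + k) : ℂ) = 0 := by
    intro p q hq
    have hae : (fun z => inner ℂ (monomialLp hα p q z) (f z)) =ᵐ[diskMeasure α]
        fun z => ∑ k ∈ Finset.range n, monomial q (p + k) z * h k z := by
      filter_upwards [(memLp_monomial hα p q).coeFn_toLp, hfg, ae_mem_unitDisk α] with z h1 h2 hz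
      rw [monomialLp, h1, h2, hgh z hz, RCLike.inner_apply', Finset.mul_sum]
      refine Finset.sum_congr rfl fun k _ => ?_
      simp only [monomial, map_mul, map_pow, Complex.conj_conj, pow_add]
      ring
    have hint : Integrable (fun z => ∑ k ∈ Finset.range n, monomial q (p + k) z * h k z)
        (diskMeasure α) :=
      (L2.integrable_inner (𝕜 := ℂ) (monomialLp hα p q) f).congr hae
    have h1 := tendsto_setIntegral_ball hint
    have h2 : ∫ z, ∑ k ∈ Finset.range n, monomial q (p + k) z * h k z ∂(diskMeasure α) = 0 := by
      rw [← integral_congr_ae hae, ← L2.inner_def, h0 p q hq]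
    rw [h2] at h1
    have h3 : ∀ m : ℕ, ∫ z in Metric.ball 0 (1 - 1 / ((m : ℝ) + 2)),
        ∑ k ∈ Finset.range n, monomial q (p + k) z * h k z ∂(diskMeasure α) =
        ∑ k ∈ Finset.range n, (if q ≤ p + k then a k (p + k - q) else 0) *
          ∫ z in Metric.ball 0 (1 - 1 / ((m : ℝ) + 2)),
            monomial (p + k) (p + k) z ∂(diskMeasure α) := by
      intro m
      have hm : (0 : ℝ) < 1 / ((m : ℝ) + 2) := by positivity
      have hm' : 1 / ((m : ℝ) + 2) < 1 := by
        rw [div_lt_one (by positivity)]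
        linarith [(Nat.cast_nonneg m : (0 : ℝ) ≤ m)]
      rw [integral_finsetSum]
      · refine Finset.sum_congr rfl fun k _ => ?_
        rw [setIntegral_monomial_mul hα (by linarith) (by linarith) (ha k)]
        split_ifs <;> simp
      · intro k _
        refine IntegrableOn.mono_set (t := Metric.closedBall 0 (1 - 1 / ((m : ℝ) + 2))) ?_
          Metric.ball_subset_closedBall
        refine ContinuousOn.integrableOn_compact (isCompact_closedBall _ _) ?_
        exact (continuous_monomial _ _).continuousOn.mul
          ((hh k).continuousOn.mono (Metric.closedBall_subset_ball (by linarith)))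
    simp only [h3] at h1
    refine tendsto_nhds_unique (tendsto_finsetSum _ fun k _ => ?_) h1
    rw [← integral_monomial_self hα]
    exact (tendsto_setIntegral_ball (integrable_monomial hα _ _)).const_mul _
  have hzero : ∀ k < n, ∀ j, a k j = 0 := by
    intro k hk j
    let ξ : Freq n := ⟨(j : ℤ) - k, by omega⟩
    let c : Fin n → ℂ := fun l => if (l : ℤ) + ξ.1 < 0 then 0 else a l ((l : ℤ) + ξ.1).toNat
    have hc : ∀ l : Fin n, (l : ℤ) + ξ.1 < 0 → c l = 0 := fun l hl => if_pos hl
    have horth : ∀ q : Fin n, 0 ≤ (q : ℤ) + ξ.1 →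
        inner ℂ (monomialLp hα ((q : ℤ) + ξ.1).toNat q)
          (∑ l : Fin n, c l • monomialLp hα ((l : ℤ) + ξ.1).toNat l) = 0 := by
      intro q hq
      rw [← key ((q : ℤ) + ξ.1).toNat q q.2, Finset.sum_range, inner_sum]
      refine Finset.sum_congr rfl fun l _ => ?_
      rw [inner_smul_right]
      by_cases hl : (l : ℤ) + ξ.1 < 0
      · rw [hc l hl, if_neg (by omega), zero_mul, zero_mul]
      · rw [inner_monomialLp, if_pos (by omega), if_pos (by omega)]
        simp only [c, if_neg hl]
        congr 2
        omega
    have h1 : ∑ l : Fin n, c l • monomialLp hα ((l : ℤ) + ξ.1).toNat l = 0 := by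
      rw [← inner_self_eq_zero (𝕜 := ℂ)]
      conv_lhs => rw [sum_inner]
      refine Finset.sum_eq_zero fun l _ => ?_
      rw [inner_smul_left]
      by_cases hl : (l : ℤ) + ξ.1 < 0
      · rw [hc l hl, map_zero, zero_mul]
      · rw [horth l (by omega), mul_zero]
    have h2 := congrFun (linearIndependent_block hα ξ hc h1) ⟨k, hk⟩
    simp only [c, ξ, Pi.zero_apply] at h2
    rw [if_neg (by omega)] at h2
    convert! h2 using 2
    omega
  apply Lp.ext
  filter_upwards [hfg, ae_mem_unitDisk α, Lp.coeFn_zero ℂ 2 (diskMeasure α)] with z h1 hz h2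
  rw [h1, h2, hgh z hz, Pi.zero_apply]
  refine Finset.sum_eq_zero fun k hk => ?_
  have h3 := ha k z hz
  simp only [hzero k (Finset.mem_range.1 hk), zero_mul] at h3
  rw [h3.unique hasSum_zero, mul_zero]

lemma bergman_eq_closure (n : ℕ) {α : ℝ} (hα : -1 < α) :
    bergman n α = (⨆ ξ : Freq n, freqBlock n hα ξ).topologicalClosure := by
  set H := (⨆ ξ : Freq n, freqBlock n hα ξ).topologicalClosure with hH
  have hle : H ≤ bergman n α := closure_iSup_freqBlock_le_bergman n hα
  have hcomp : CompleteSpace H := (Submodule.isClosed_topologicalClosure _).completeSpace_coe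
  refine le_antisymm (fun f hf => ?_) hle
  have h1 : f - H.starProjection f ∈ bergman n α :=
    sub_mem hf (hle (Submodule.starProjection_apply_mem H f))
  have h2 : f - H.starProjection f ∈ Hᗮ := Submodule.sub_starProjection_mem_orthogonal f
  have h3 := eq_zero_of_mem_bergman_of_inner_eq_zero hα h1 fun p q hq =>
    (Submodule.mem_orthogonal _ _).1 h2 _ (Submodule.le_topologicalClosure _
      (Submodule.mem_iSup_of_mem (⟨(p : ℤ) - q, by omega⟩ : Freq n)
        (Submodule.subset_span ⟨p, q, rfl, by simp only [blockSize]; omega, rfl⟩)))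
  rw [sub_eq_zero.1 h3]
  exact Submodule.starProjection_apply_mem H f

/-- The Bergman space of `n`-analytic functions is a Hilbert space. -/
lemma completeSpace_bergman (n : ℕ) {α : ℝ} (hα : -1 < α) : CompleteSpace (bergman n α) := by
  rw [bergman_eq_closure n hα]
  exact (Submodule.isClosed_topologicalClosure _).completeSpace_coe

/-! ### The Bergman space as the Hilbert sum of the frequency blocks -/

/-- The inclusion of a frequency block into the Bergman space. -/
noncomputable def blockInclusion (n : ℕ) {α : ℝ} (hα : -1 < α) (ξ : Freq n) :
    freqBlock n hα ξ →ₗᵢ[ℂ] bergman n α where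
  toLinearMap := Submodule.inclusion (freqBlock_le_bergman n hα ξ)
  norm_map' _ := rfl

lemma isHilbertSum_blockInclusion (n : ℕ) {α : ℝ} (hα : -1 < α) [CompleteSpace (bergman n α)] :
    IsHilbertSum ℂ (fun ξ : Freq n => freqBlock n hα ξ) (blockInclusion n hα) := by
  have hV := orthogonalFamily_freqBlock n hα
  have hW : OrthogonalFamily ℂ (fun ξ : Freq n => freqBlock n hα ξ) (blockInclusion n hα) :=
    fun ξ η h x y => hV h x y
  refine IsHilbertSum.ofSurjective hW fun f => ?_
  have h1 := hV.range_linearIsometry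
  simp only [Submodule.subtypeₗᵢ_toLinearMap, Submodule.range_subtype] at h1
  have hf : (f : L2 α) ∈ (⨆ ξ : Freq n, freqBlock n hα ξ).topologicalClosure := by
    rw [← bergman_eq_closure n hα]
    exact f.2
  rw [← h1] at hf
  obtain ⟨g, hg⟩ := hf
  refine ⟨g, Subtype.ext ?_⟩
  have h2 := (hW.hasSum_linearIsometry g).mapL (bergman n α).subtypeL
  rw [← hg]
  exact h2.unique (hV.hasSum_linearIsometry g)

lemma diskPolyLp_mem_freqBlock {n : ℕ} {α : ℝ} (hα : -1 < α) (ξ : Freq n) (q : BlockIndex ξ) :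
    diskPolyLp hα ((q.1 : ℤ) + ξ.1).toNat q.1 ∈ freqBlock n hα ξ := by
  rw [diskPolyLp_eq_sum]
  refine Submodule.smul_mem _ _ (sum_mem fun k hk => Submodule.smul_mem _ _
    (Submodule.subset_span ⟨_, _, ?_, ?_, rfl⟩))
  · have := Finset.mem_range.1 hk
    have := q.2
    omega
  · have := q.2
    have := q.1.2
    unfold blockSize
    omega

/-- The monomials `z ^ (q + ξ) * z̄ ^ q` span the block. -/
lemma finrank_freqBlock_le {n : ℕ} {α : ℝ} (hα : -1 < α) (ξ : Freq n) :
    Module.finrank ℂ (freqBlock n hα ξ) ≤ Fintype.card (BlockIndex ξ) := by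
  let w : BlockIndex ξ → L2 α := fun q => monomialLp hα ((q.1 : ℤ) + ξ.1).toNat q.1
  have h1 : freqBlock n hα ξ ≤ Submodule.span ℂ (Set.range w) := fun f hf => by
    obtain ⟨c, hc, rfl⟩ := exists_eq_sum_of_mem_freqBlock hα hf
    refine sum_mem fun k _ => ?_
    by_cases hk : (k : ℤ) + ξ.1 < 0
    · rw [hc k hk, zero_smul]
      exact zero_mem _
    · exact Submodule.smul_mem _ _ (Submodule.subset_span ⟨⟨k, not_lt.1 hk⟩, rfl⟩)
  have : FiniteDimensional ℂ (Submodule.span ℂ (Set.range w)) :=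
    FiniteDimensional.span_of_finite ℂ (Set.finite_range w)
  exact (Submodule.finrank_mono h1).trans (finrank_range_le_card w)

lemma orthonormal_diskPolyLp_block {n : ℕ} {α : ℝ} (hα : -1 < α) (ξ : Freq n) :
    Orthonormal ℂ fun q : BlockIndex ξ =>
      (⟨_, diskPolyLp_mem_freqBlock hα ξ q⟩ : freqBlock n hα ξ) := by
  have h := (orthonormal_diskPolyLp hα).comp
    (fun q : BlockIndex ξ => (((q.1 : ℤ) + ξ.1).toNat, (q.1 : ℕ))) fun q q' h =>
      Subtype.ext (Fin.ext (Prod.ext_iff.1 h).2)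
  exact ⟨fun q => h.1 q, fun q q' hq => h.2 hq⟩

/-- The disk polynomials with frequency `ξ` form an orthonormal basis of the block. -/
noncomputable def blockBasis (n : ℕ) {α : ℝ} (hα : -1 < α) (ξ : Freq n) :
    OrthonormalBasis (BlockIndex ξ) ℂ (freqBlock n hα ξ) :=
  have hv := (orthonormal_diskPolyLp_block hα ξ).linearIndependent
  OrthonormalBasis.mk (orthonormal_diskPolyLp_block hα ξ)
    (hv.span_eq_top_of_card_eq_finrank'
      (le_antisymm hv.fintype_card_le_finrank (finrank_freqBlock_le hα ξ))).ge

lemma coe_blockBasis (n : ℕ) {α : ℝ} (hα : -1 < α) (ξ : Freq n) (q : BlockIndex ξ) :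
    (blockBasis n hα ξ q : L2 α) = diskPolyLp hα ((q.1 : ℤ) + ξ.1).toNat q.1 := by
  rw [blockBasis, OrthonormalBasis.coe_mk]

/-- The isometry of `ℂ ^ min {n, n + ξ}` onto the block with frequency `ξ` that is given by the
disk polynomials. -/
noncomputable def coordInclusion (n : ℕ) {α : ℝ} (hα : -1 < α) (ξ : Freq n) :
    EuclideanSpace ℂ (BlockIndex ξ) →ₗᵢ[ℂ] bergman n α :=
  (blockInclusion n hα ξ).comp (blockBasis n hα ξ).repr.symm.toLinearIsometry

lemma isHilbertSum_coordInclusion (n : ℕ) {α : ℝ} (hα : -1 < α) [CompleteSpace (bergman n α)] :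
    IsHilbertSum ℂ (fun ξ : Freq n => EuclideanSpace ℂ (BlockIndex ξ)) (coordInclusion n hα) :=
  (isHilbertSum_blockInclusion n hα).comp_linearIsometryEquiv fun ξ => (blockBasis n hα ξ).repr.symm

/-- The coordinates of a function in the Hilbert sum are its inner products with the disk
polynomials. -/
lemma coordInclusion_isHilbertSum_apply (n : ℕ) {α : ℝ} (hα : -1 < α)
    [CompleteSpace (bergman n α)] (f : bergman n α) (ξ : Freq n) (q : BlockIndex ξ) :
    (isHilbertSum_coordInclusion n hα).linearIsometryEquiv f ξ q =
      inner ℂ (diskPolyLp hα ((q.1 : ℤ) + ξ.1).toNat q.1) (f : L2 α) := by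
  have h := (isHilbertSum_coordInclusion n hα).inner_linearIsometryEquiv_apply f ξ
    (EuclideanSpace.single q 1)
  rw [EuclideanSpace.inner_single_left, map_one, one_mul] at h
  rw [h, ← coe_blockBasis, ← OrthonormalBasis.repr_symm_single]
  rfl

/-! ### Rotations and the frequency blocks -/

lemma rotation_monomialLp {α : ℝ} (hα : -1 < α) (τ : Circle) (p q : ℕ) :
    rotation α τ (monomialLp hα p q) =
      ((τ⁻¹ ^ ((p : ℤ) - q) : Circle) : ℂ) • monomialLp hα p q := by
  apply Lp.ext
  have h := (memLp_monomial hα p q).coeFn_toLp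
  filter_upwards [rotation_coeFn α τ (monomialLp hα p q),
    Lp.coeFn_smul ((τ⁻¹ ^ ((p : ℤ) - q) : Circle) : ℂ) (monomialLp hα p q), h,
    (measurePreserving_rotation α τ).quasiMeasurePreserving.ae_eq_comp h] with z h1 h2 h3 h4
  rw [h1, h2, Pi.smul_apply, monomialLp, h3, smul_eq_mul, ← monomial_circle_mul]
  exact h4

lemma rotation_of_mem_freqBlock {n : ℕ} {α : ℝ} (hα : -1 < α) (τ : Circle) {ξ : Freq n} {f : L2 α}
    (hf : f ∈ freqBlock n hα ξ) : rotation α τ f = ((τ⁻¹ ^ ξ.1 : Circle) : ℂ) • f := by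
  induction hf using Submodule.span_induction with
  | mem f hf =>
    obtain ⟨p, q, h1, h2, rfl⟩ := hf
    rw [← h1]
    exact rotation_monomialLp hα τ p q
  | zero => simp
  | add f g _ _ hf hg => rw [map_add, hf, hg, smul_add]
  | smul r f _ hf => rw [map_smul, hf, smul_comm]

lemma inner_rotation_rotation {α : ℝ} (τ : Circle) (f g : L2 α) :
    inner ℂ (rotation α τ f) (rotation α τ g) = inner ℂ f g :=
  (Lp.compMeasurePreservingₗᵢ ℂ (fun z : ℂ => ((τ⁻¹ : Circle) : ℂ) * z)
    (measurePreserving_rotation α τ)).inner_map_map f g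

lemma bergmanRotation_blockInclusion {n : ℕ} {α : ℝ} (hα : -1 < α) (τ : Circle) (ξ : Freq n)
    (x : freqBlock n hα ξ) :
    bergmanRotation n α τ (blockInclusion n hα ξ x) =
      ((τ⁻¹ ^ ξ.1 : Circle) : ℂ) • blockInclusion n hα ξ x :=
  Subtype.ext (rotation_of_mem_freqBlock hα τ x.2)

/-- The joint eigenvectors of the rotations belong to the frequency blocks. -/
lemma mem_freqBlock_of_rotation {n : ℕ} {α : ℝ} (hα : -1 < α) {ξ : Freq n} {f : bergman n α}
    (hf : ∀ τ, bergmanRotation n α τ f = ((τ⁻¹ ^ ξ.1 : Circle) : ℂ) • f) :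
    (f : L2 α) ∈ freqBlock n hα ξ := by
  have := completeSpace_bergman n hα
  have hV := isHilbertSum_blockInclusion n hα
  have h1 : ∀ η, η ≠ ξ → hV.linearIsometryEquiv f η = 0 := by
    intro η hη
    refine ext_inner_left ℂ fun y => ?_
    rw [hV.inner_linearIsometryEquiv_apply, inner_zero_right]
    obtain ⟨c, hc⟩ := exists_circle_zpow_ne_one (k := ξ.1 - η.1)
      (sub_ne_zero.2 fun h => hη (Subtype.ext h.symm))
    change inner ℂ (y : L2 α) (f : L2 α) = 0
    have h2 := inner_rotation_rotation c⁻¹ (y : L2 α) (f : L2 α)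
    have hf' : rotation α c⁻¹ f = ((c⁻¹⁻¹ ^ ξ.1 : Circle) : ℂ) • (f : L2 α) :=
      congrArg Subtype.val (hf c⁻¹)
    rw [rotation_of_mem_freqBlock hα c⁻¹ y.2, hf', inv_inv, inner_smul_left, inner_smul_right,
      ← mul_assoc, ← Circle.coe_inv_eq_conj, ← Circle.coe_mul, ← zpow_neg, ← zpow_add] at h2
    have e : -η.1 + ξ.1 = ξ.1 - η.1 := by ring
    rw [e] at h2
    have h3 : (((c ^ (ξ.1 - η.1) : Circle) : ℂ) - 1) * inner ℂ (y : L2 α) (f : L2 α) = 0 := by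
      rw [sub_mul, h2, one_mul, sub_self]
    refine (mul_eq_zero.1 h3).resolve_left fun h0 => hc ?_
    exact Circle.ext (by simpa using sub_eq_zero.1 h0)
  have h2 := (hV.hasSum_linearIsometryEquiv f).unique
    (hasSum_single ξ fun η hη => by rw [h1 η hη, map_zero])
  rw [h2]
  exact (hV.linearIsometryEquiv f ξ).2

/-- The radial operators are the operators that leave the frequency blocks invariant. -/
lemma mem_radialOperators_iff {n : ℕ} {α : ℝ} (hα : -1 < α) (S : bergman n α →L[ℂ] bergman n α) :
    S ∈ radialOperators n α ↔ ∀ (ξ : Freq n) (f : bergman n α), (f : L2 α) ∈ freqBlock n hα ξ →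
      (S f : L2 α) ∈ freqBlock n hα ξ := by
  constructor
  · intro hS ξ f hf
    refine mem_freqBlock_of_rotation hα fun τ => ?_
    have h1 : bergmanRotation n α τ f = ((τ⁻¹ ^ ξ.1 : Circle) : ℂ) • f :=
      bergmanRotation_blockInclusion hα τ ξ ⟨f, hf⟩
    have h2 : bergmanRotation n α τ (S f) = S (bergmanRotation n α τ f) :=
      congrArg (fun T : bergman n α →L[ℂ] bergman n α => T f) (hS τ)
    rw [h2, h1, map_smul]
  · intro hS τ
    have := completeSpace_bergman n hα
    refine (isHilbertSum_blockInclusion n hα).clm_ext fun ξ x => ?_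
    have h1 := hS ξ (blockInclusion n hα ξ x) x.2
    have h2 : bergmanRotation n α τ (S (blockInclusion n hα ξ x)) =
        ((τ⁻¹ ^ ξ.1 : Circle) : ℂ) • S (blockInclusion n hα ξ x) :=
      bergmanRotation_blockInclusion hα τ ξ ⟨_, h1⟩
    change bergmanRotation n α τ (S (blockInclusion n hα ξ x)) =
      S (bergmanRotation n α τ (blockInclusion n hα ξ x))
    rw [h2, bergmanRotation_blockInclusion, map_smul]

lemma mem_radialOperators_iff_blockInclusion {n : ℕ} {α : ℝ} (hα : -1 < α)
    (S : bergman n α →L[ℂ] bergman n α) :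
    S ∈ radialOperators n α ↔
      ∀ ξ x, ∃ y, S (blockInclusion n hα ξ x) = blockInclusion n hα ξ y := by
  rw [mem_radialOperators_iff hα]
  constructor
  · intro h ξ x
    exact ⟨⟨_, h ξ (blockInclusion n hα ξ x) x.2⟩, rfl⟩
  · intro h ξ f hf
    obtain ⟨y, hy⟩ := h ξ ⟨f, hf⟩
    have h1 : S f = blockInclusion n hα ξ y := hy
    rw [h1]
    exact y.2

lemma mem_radialOperators_iff_coordInclusion {n : ℕ} {α : ℝ} (hα : -1 < α)
    (S : bergman n α →L[ℂ] bergman n α) :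
    S ∈ radialOperators n α ↔
      ∀ ξ x, ∃ y, S (coordInclusion n hα ξ x) = coordInclusion n hα ξ y := by
  rw [mem_radialOperators_iff_blockInclusion hα]
  constructor
  · intro h ξ x
    obtain ⟨y, hy⟩ := h ξ ((blockBasis n hα ξ).repr.symm x)
    exact ⟨(blockBasis n hα ξ).repr y, by simpa [coordInclusion] using hy⟩
  · intro h ξ x
    obtain ⟨y, hy⟩ := h ξ ((blockBasis n hα ξ).repr x)
    exact ⟨(blockBasis n hα ξ).repr.symm y, by simpa [coordInclusion] using hy⟩

lemma star_bergmanRotation {n : ℕ} {α : ℝ} (hα : -1 < α) [CompleteSpace (bergman n α)]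
    (τ : Circle) : star (bergmanRotation n α τ) = bergmanRotation n α τ⁻¹ := by
  have h1 : ∀ f, bergmanRotation n α τ (bergmanRotation n α τ⁻¹ f) = f := fun f => by
    have : bergmanRotation n α τ * bergmanRotation n α τ⁻¹ = 1 :=
      (isHilbertSum_blockInclusion n hα).clm_ext fun ξ x => by
        change bergmanRotation n α τ (bergmanRotation n α τ⁻¹ _) = _
        rw [bergmanRotation_blockInclusion, map_smul, bergmanRotation_blockInclusion, smul_smul,
          ← Circle.coe_mul, ← mul_zpow]
        simp
    exact congrArg (fun T : bergman n α →L[ℂ] bergman n α => T f) this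
  rw [ContinuousLinearMap.star_eq_adjoint]
  refine ((ContinuousLinearMap.eq_adjoint_iff _ _).2 fun f g => ?_).symm
  have h2 : inner ℂ (bergmanRotation n α τ (bergmanRotation n α τ⁻¹ f)) (bergmanRotation n α τ g) =
      inner ℂ (bergmanRotation n α τ⁻¹ f) g := inner_rotation_rotation τ _ _
  rw [← h2, h1]

/-- The von Neumann algebra of radial operators, as the commutant of the rotations. -/
noncomputable def radialAlgebra (n : ℕ) (α : ℝ) [CompleteSpace (bergman n α)] :
    VonNeumannAlgebra (bergman n α) where
  toStarSubalgebra := StarSubalgebra.centralizer ℂ (Set.range (bergmanRotation n α))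
  centralizer_centralizer' := by
    let C := StarSubalgebra.centralizer ℂ (Set.range (bergmanRotation n α))
    change Set.centralizer (Set.centralizer (C : Set (bergman n α →L[ℂ] bergman n α))) = C
    rw [StarSubalgebra.coe_centralizer, Set.centralizer_centralizer_centralizer]

lemma mem_radialAlgebra {n : ℕ} {α : ℝ} (hα : -1 < α) [CompleteSpace (bergman n α)]
    (S : bergman n α →L[ℂ] bergman n α) : S ∈ radialAlgebra n α ↔ S ∈ radialOperators n α := by
  change S ∈ StarSubalgebra.centralizer ℂ (Set.range (bergmanRotation n α)) ↔ _
  rw [StarSubalgebra.mem_centralizer_iff]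
  constructor
  · intro h τ
    exact (h _ ⟨τ, rfl⟩).1
  · rintro h _ ⟨τ, rfl⟩
    rw [star_bergmanRotation hα]
    exact ⟨h τ, h τ⁻¹⟩

lemma ActsAs.unique {n : ℕ} {A : MatrixSum n} {T T' : SeqSpace n →L[ℂ] SeqSpace n}
    (h : ActsAs A T) (h' : ActsAs A T') : T = T' := by
  ext v ξ j
  rw [h, h']

lemma conjOp_apply {n : ℕ} {α : ℝ} (U : bergman n α ≃ₗᵢ[ℂ] SeqSpace n)
    (S : bergman n α →L[ℂ] bergman n α) (v : SeqSpace n) : conjOp U S v = U (S (U.symm v)) := rfl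

/-- The matrix units `E₀₁` and `E₁₀` in the block with frequency zero do not commute. -/
lemma exists_matrixSum_not_commute {n : ℕ} (hn : 2 ≤ n) :
    ∃ A B : MatrixSum n, A * B ≠ B * A := by
  let ξ : Freq n := ⟨0, by omega⟩
  let i : BlockIndex ξ := ⟨⟨0, by omega⟩, by simp [ξ]⟩
  let j : BlockIndex ξ := ⟨⟨1, by omega⟩, by simp [ξ]⟩
  have hij : i ≠ j := fun h => by simp [i, j] at h
  refine ⟨lp.single ∞ ξ (Matrix.single i j 1), lp.single ∞ ξ (Matrix.single j i 1), fun h => ?_⟩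
  have h1 := congrArg (fun A : MatrixSum n => A ξ i i) h
  simp only [lp.infty_coeFn_mul, Pi.mul_apply, lp.single_apply_self] at h1
  simp [hij.symm] at h1

/-! ### The algebra of radial operators as a direct sum -/

lemma exists_starAlgEquiv_blockOpSum {n : ℕ} {α : ℝ} (hα : -1 < α) [CompleteSpace (bergman n α)] :
    ∃ Ψ : (radialAlgebra n α).toStarSubalgebra ≃⋆ₐ[ℂ] BlockOpSum n hα, Isometry Ψ ∧
      ∀ (S : (radialAlgebra n α).toStarSubalgebra) (ξ : Freq n) (f : freqBlock n hα ξ),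
        ((Ψ S ξ).apply f : L2 α) =
          S.1 (⟨f.1, freqBlock_le_bergman n hα ξ f.2⟩ : bergman n α) := by
  have h := (isHilbertSum_blockInclusion n hα).exists_starAlgEquiv_lp
    (radialAlgebra n α).toStarSubalgebra
    (fun S => (mem_radialAlgebra hα S).trans (mem_radialOperators_iff_blockInclusion hα S))
    (A := fun ξ => BlockOp n hα ξ)
    -- `BlockOp` is the algebra of bounded operators on the block by definition
    (fun ξ => StarAlgEquiv.refl ℂ (freqBlock n hα ξ →L[ℂ] freqBlock n hα ξ))
    (fun _ _ => rfl)
  refine h.imp fun Ψ hΨ => ⟨hΨ.1, fun S ξ f => ?_⟩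
  exact (congrArg Subtype.val (hΨ.2 S ξ f)).symm

lemma exists_starAlgEquiv_matrixSum {n : ℕ} {α : ℝ} (hα : -1 < α) [CompleteSpace (bergman n α)] :
    ∃ Φ : (radialAlgebra n α).toStarSubalgebra ≃⋆ₐ[ℂ] MatrixSum n, Isometry Φ ∧
      ∀ S : (radialAlgebra n α).toStarSubalgebra,
        ActsAs (Φ S) (conjOp (isHilbertSum_coordInclusion n hα).linearIsometryEquiv S.1) := by
  have hW := isHilbertSum_coordInclusion n hα
  have h := hW.exists_starAlgEquiv_lp (radialAlgebra n α).toStarSubalgebra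
    (fun S => (mem_radialAlgebra hα S).trans (mem_radialOperators_iff_coordInclusion hα S))
    (A := fun ξ : Freq n => Matrix (BlockIndex ξ) (BlockIndex ξ) ℂ)
    (fun ξ => Matrix.toEuclideanCLM (n := BlockIndex ξ) (𝕜 := ℂ))
    (fun _ _ => rfl)
  refine h.imp fun Φ hΦ => ⟨hΦ.1, fun S v ξ j => ?_⟩
  rw [conjOp_apply, hW.linearIsometryEquiv_apply_of_blockDiagonal (hΦ.2 S),
    LinearIsometryEquiv.apply_symm_apply, Matrix.ofLp_toEuclideanCLM]
  rfl

lemma image_conjOp_eq_matrixOperators {n : ℕ} {α : ℝ} [CompleteSpace (bergman n α)]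
    {U : bergman n α ≃ₗᵢ[ℂ] SeqSpace n}
    (Φ : (radialAlgebra n α).toStarSubalgebra ≃⋆ₐ[ℂ] MatrixSum n)
    (hΦ : ∀ S : (radialAlgebra n α).toStarSubalgebra, ActsAs (Φ S) (conjOp U S.1)) :
    conjOp U '' (radialAlgebra n α : Set (bergman n α →L[ℂ] bergman n α)) = matrixOperators n := by
  refine Set.Subset.antisymm ?_ ?_
  · rintro _ ⟨S, hS, rfl⟩
    exact ⟨Φ ⟨S, hS⟩, hΦ ⟨S, hS⟩⟩
  · rintro T ⟨A, hA⟩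
    refine ⟨(Φ.symm A).1, (Φ.symm A).2, ActsAs.unique ?_ hA⟩
    have := hΦ (Φ.symm A)
    rwa [StarAlgEquiv.apply_symm_apply] at this

lemma exists_radialAlgebra_not_commute {n : ℕ} {α : ℝ} [CompleteSpace (bergman n α)] (hn : 2 ≤ n)
    (Φ : (radialAlgebra n α).toStarSubalgebra ≃⋆ₐ[ℂ] MatrixSum n) :
    ∃ S ∈ radialAlgebra n α, ∃ T ∈ radialAlgebra n α, S * T ≠ T * S := by
  obtain ⟨A, B, hAB⟩ := exists_matrixSum_not_commute hn
  refine ⟨(Φ.symm A).1, (Φ.symm A).2, (Φ.symm B).1, (Φ.symm B).2, fun h => hAB ?_⟩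
  have h1 : Φ.symm A * Φ.symm B = Φ.symm B * Φ.symm A := Subtype.ext h
  rw [← map_mul, ← map_mul] at h1
  exact Φ.symm.injective h1

end PolyBergman

theorem theorem7p1 (n : ℕ) (hn : 1 ≤ n) (α : ℝ) (hα : -1 < α) :
    ∃ (_ : CompleteSpace (bergman n α)) (R : VonNeumannAlgebra (bergman n α)),
      -- the radial operators form a von Neumann algebra `R`
      (R : Set (bergman n α →L[ℂ] bergman n α)) = radialOperators n α ∧
      -- description by invariant subspaces
      (∀ S : bergman n α →L[ℂ] bergman n α, S ∈ R ↔
        ∀ (ξ : Freq n) (f : bergman n α), (f : L2 α) ∈ freqBlock n hα ξ →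
          (S f : L2 α) ∈ freqBlock n hα ξ) ∧
      -- isomorphism with the direct sum of the algebras of operators on the blocks
      (∃ Ψ : R.toStarSubalgebra ≃⋆ₐ[ℂ] BlockOpSum n hα,
        Isometry Ψ ∧
        ∀ (S : R.toStarSubalgebra) (ξ : Freq n) (f : freqBlock n hα ξ),
          ((Ψ S ξ).apply f : L2 α) =
            S.1 (⟨f.1, freqBlock_le_bergman n hα ξ f.2⟩ : bergman n α)) ∧
      -- spatial isomorphism with the direct sum of matrix algebras
      (∃ U : bergman n α ≃ₗᵢ[ℂ] SeqSpace n,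
        (∀ (f : bergman n α) (ξ : Freq n) (q : BlockIndex ξ),
          U f ξ q = inner ℂ (diskPolyLp hα ((q.1 : ℤ) + ξ.1).toNat q.1) (f : L2 α)) ∧
        conjOp U '' (R : Set (bergman n α →L[ℂ] bergman n α)) = matrixOperators n ∧
        ∃ Φ : R.toStarSubalgebra ≃⋆ₐ[ℂ] MatrixSum n,
          Isometry Φ ∧ ∀ S : R.toStarSubalgebra, ActsAs (Φ S) (conjOp U S.1)) ∧
      -- noncommutativity
      (2 ≤ n → ∃ S ∈ R, ∃ T ∈ R, S * T ≠ T * S) := by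
  have hcomp := completeSpace_bergman n hα
  have hΦ := exists_starAlgEquiv_matrixSum (n := n) hα
  exact ⟨hcomp, radialAlgebra n α, Set.ext fun S => mem_radialAlgebra hα S,
    fun S => (mem_radialAlgebra hα S).trans (mem_radialOperators_iff hα S),
    exists_starAlgEquiv_blockOpSum hα,
    ⟨(isHilbertSum_coordInclusion n hα).linearIsometryEquiv,
      coordInclusion_isHilbertSum_apply n hα,
      hΦ.elim fun Φ hΦ => image_conjOp_eq_matrixOperators Φ hΦ.2, hΦ⟩,
    fun hn2 => hΦ.elim fun Φ _ => exists_radialAlgebra_not_commute hn2 Φ⟩
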